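/- **Setting.** Let $\mathcal K$ be a field, $\Gamma\le\mathbb R$ an additive subgroup, and let $$\Lambda=\Lambda^{\mathcal K,\Gamma}=\Big\{\sum_{g\in\Gamma}a_gT^g \;\Big|\; a_g\in\mathcal K,\ \#\{g\mid a_g\neq0,\ g<c\}<\infty\text{ for all }c\in\mathbb R\Big\}$$ be the Novikov field, with valuation $\nu(\sum a_gT^g)=\min\{g\mid a_g\ne 0\}$ and $\nu(0)=\infty$. An *orthogonalizable $\Lambda$-space* is a finite-dimensional $\Lambda$-vector space $V$ with a function $\ell:V\to\mathbb R\cup\{-\infty\}$ such that $\ell(x)=-\infty$ iff $x=0$, $\ell(\lambda x)=\ell(x)-\nu(\lambda)$, $\ell(x+y)\le\max\{\ell(x),\ell(y)\}$, and such that $V$ has an orthogonal basis; here $(w_1,\dots,w_r)$ is *orthogonal* if $\ell(\sum\lambda_iw_i)=\max_i\ell(\lambda_iw_i)$ for all $\lambda_i\in\Lambda$. A *Floer-type complex* $(C_*,\partial,\ell)$ is a chain complex $(C_k)_{k\in\mathbb Z}$ of $\Lambda$-vector spaces with functions $\ell:C_k\to\mathbb R\cup\{-\infty\}$ that make every $C_k$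 an orthogonalizable $\Lambda$-space, and with $\ell(\partial x)\le\ell(x)$ for all $x\in C_k$. A *singular value decomposition* of a linear map $A:V\to W$ of rank $r$ consists of orthogonal ordered bases $(y_1,\dots,y_n)$ of $V$ and $(x_1,\dots,x_m)$ of $W$ such that $(y_{r+1},\dots,y_n)$ is a basis of $\ker A$, $(x_1,\dots,x_r)$ is a basis of $\operatorname{im}A$, $Ay_i=x_i$ for $i\le r$, and $\ell(y_1)-\ell(x_1)\ge\dots\ge\ell(y_r)-\ell(x_r)$. The degree-$k$ *verbose barcode* of $C_*$ is the multiset of elements of $(\mathbb R/\Gamma)\times[0,\infty]$ formed, from a singular value decomposition of $\partial_{k+1}:C_{k+1}\to\ker\partial_k$, by the pairs $([\ell(x_i)],\ell(y_i)-\ell(x_i))$ for $i\le r$ and $([\ell(x_i)],\infty)$ for $r<i\le m$. The degree-$k$ *concise barcode* $\mathcal B_{C,k}$ consists of the elements of the verbose barcode with positive second coordinate. For $\delta\in[0,\infty)$, a *$\delta$-matching* of finite multisets $\mathcal S,\mathcal T$ of elements of $(\mathbb R/\Gamma)\times[0,\infty]$ consists of submultisets $\mathcal S_{short}\subset\mathcal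 S$ and $\mathcal T_{short}\subset\mathcal T$ all of whose elements have second coordinate $\le2\delta$, and a bijection $\sigma:\mathcal S\setminus\mathcal S_{short}\to\mathcal T\setminus\mathcal T_{short}$ such that, whenever $\sigma([a],L)=([a'],L')$, for every $\epsilon>0$ the representative $a'$ can be chosen so that $|a'-a|\le\delta+\epsilon$ and either $L=L'=\infty$ or $L,L'<\infty$ and $|(a'+L')-(a+L)|\le\delta+\epsilon$. The *bottleneck distance* $d_B(\mathcal S,\mathcal T)\in[0,\infty]$ is the infimum of all $\delta\ge 0$ for which a $\delta$-matching exists, and $d_B(\mathcal B_C,\mathcal B_D)=\sup_{k\in\mathbb Z}d_B(\mathcal B_{C,k},\mathcal B_{D,k})$. For $\delta\in[0,\infty)$, a *$\delta$-quasiequivalence* between $C_*$ and $D_*$ consists of chain maps $\Phi:C_*\to D_*$, $\Psi:D_*\to C_*$ and degree-one linear maps $K_C:C_*\to C_{*+1}$, $K_D:D_*\to D_{*+1}$ with $\Psi\Phi-I=\partial_CK_C+K_C\partial_C$, $\Phi\Psi-I=\partial_DK_D+K_D\partial_D$, and, for all $k$ and all $c\in C_k$, $d\in D_k$, $\ell_D(\Phi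 c)\le\ell_C(c)+\delta$, $\ell_C(\Psi d)\le\ell_D(d)+\delta$, $\ell_C(K_Cc)\le\ell_C(c)+2\delta$, $\ell_D(K_Dd)\le\ell_D(d)+2\delta$. The *quasiequivalence distance* $d_Q(C_*,D_*)\in[0,\infty]$ is the infimum of all $\delta\ge0$ for which a $\delta$-quasiequivalence exists. (The infimum of the empty set is $\infty$.) **Theorem.** Let $(C_*,\partial_C,\ell_C)$ and $(D_*,\partial_D,\ell_D)$ be Floer-type complexes over $\Lambda$. Their concise barcodes exist in all degrees (that is, the required singular value decompositions exist), and, whichever singular value decompositions are used to compute them: (i) $d_Q(C_*,D_*)\le d_B(\mathcal B_C,\mathcal B_D)\le 2\,d_Q(C_*,D_*)$. (ii) For $k\in\mathbb Z$ let $\Delta_{D,k}\in(0,\infty]$ be the smallest second coordinate of the elements of $\mathcal B_{D,k}$ ($\infty$ if $\mathcal B_{D,k}$ is empty). If $d_Q(C_*,D_*)<\Delta_{D,k}/4$, then $d_B(\mathcal B_{C,k},\mathcal B_{D,k})\le d_Q(C_*,D_*)$. -/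

import Mathlib

open CategoryTheory
open scoped NNReal ENNReal

universe v u

noncomputable section

/-! ### The Novikov field -/

namespace Novikov

variable {K : Type*} [Field K] {Γ : AddSubgroup ℝ}

/-- Only finitely many exponents of `a = ∑ a_g T^g` lie below any given real bound. -/
def LeftFinite (a : HahnSeries Γ K) : Prop :=
  ∀ c : ℝ, {g : Γ | g ∈ a.support ∧ (g : ℝ) < c}.Finite

theorem leftFinite_zero : LeftFinite (0 : HahnSeries Γ K) := by
  intro c
  simp

theorem leftFinite_single (g : Γ) (r : K) : LeftFinite (HahnSeries.single g r) := by
  intro c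
  refine (Set.finite_singleton g).subset ?_
  rintro h ⟨hh, -⟩
  exact HahnSeries.support_single_subset hh

theorem LeftFinite.add {a b : HahnSeries Γ K} (ha : LeftFinite a) (hb : LeftFinite b) :
    LeftFinite (a + b) := by
  intro c
  refine ((ha c).union (hb c)).subset ?_
  rintro g ⟨hg, hc⟩
  rcases HahnSeries.support_add_subset _ _ hg with h | h
  · exact Or.inl ⟨h, hc⟩
  · exact Or.inr ⟨h, hc⟩

theorem LeftFinite.neg {a : HahnSeries Γ K} (ha : LeftFinite a) : LeftFinite (-a) := by
  intro c
  simpa [HahnSeries.support_neg] using ha c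

/-- The exponents of a product that are below `c`, when the exponents of the factors are
at least `p` and at least `q`. -/
theorem support_mul_lt {a b : HahnSeries Γ K} {p q : ℝ} (hp : ∀ g ∈ a.support, p ≤ (g : ℝ))
    (hq : ∀ g ∈ b.support, q ≤ (g : ℝ)) (c : ℝ) :
    {g : Γ | g ∈ (a * b).support ∧ (g : ℝ) < c} ⊆
      Set.image2 (· + ·) {g : Γ | g ∈ a.support ∧ (g : ℝ) < c - q}
        {g : Γ | g ∈ b.support ∧ (g : ℝ) < c - p} := by
  rintro g ⟨hg, hc⟩
  obtain ⟨u, hu, v, hv, rfl⟩ := HahnSeries.support_mul_subset hg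
  have h1 := hp u hu
  have h2 := hq v hv
  have h3 : (u : ℝ) + (v : ℝ) < c := by simpa using hc
  exact ⟨u, ⟨hu, by linarith⟩, v, ⟨hv, by linarith⟩, rfl⟩

theorem exists_lower (a : HahnSeries Γ K) : ∃ p : ℝ, ∀ g ∈ a.support, p ≤ (g : ℝ) :=
  ⟨(a.order : ℝ), fun g hg => by exact_mod_cast HahnSeries.order_le_of_coeff_ne_zero hg⟩

theorem LeftFinite.mul {a b : HahnSeries Γ K} (ha : LeftFinite a) (hb : LeftFinite b) :
    LeftFinite (a * b) := by
  intro c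
  obtain ⟨p, hp⟩ := exists_lower a
  obtain ⟨q, hq⟩ := exists_lower b
  exact (Set.Finite.image2 _ (ha _) (hb _)).subset (support_mul_lt hp hq c)

theorem leftFinite_of_pos {y z : HahnSeries Γ K} (hy : LeftFinite y) {p : ℝ} (hp0 : 0 < p)
    (hp : ∀ g ∈ y.support, p ≤ (g : ℝ)) (hz : z = 1 + y * z) : LeftFinite z := by
  obtain ⟨q, hq⟩ := exists_lower z
  have key : ∀ n : ℕ, {g : Γ | g ∈ z.support ∧ (g : ℝ) < q + n * p}.Finite := by
    intro n
    induction n with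
    | zero =>
      refine Set.finite_empty.subset ?_
      rintro g ⟨hg, hc⟩
      have := hq g hg
      simp at hc
      linarith
    | succ n ih =>
      refine ((Set.finite_singleton (0 : Γ)).union
        (Set.Finite.image2 (· + ·) (hy (q + (n + 1 : ℕ) * p - q)) ih)).subset ?_
      rintro g ⟨hg, hc⟩
      rw [hz] at hg
      rcases HahnSeries.support_add_subset _ _ hg with h | h
      · left
        exact HahnSeries.support_single_subset h
      · right
        have := support_mul_lt hp hq _ ⟨h, hc⟩
        have e : q + ((n + 1 : ℕ) : ℝ) * p - p = q + n * p := by push_cast; ring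
        rwa [e] at this
  intro c
  obtain ⟨n, hn⟩ := exists_nat_gt ((c - q) / p)
  refine (key n).subset ?_
  rintro g ⟨hg, hc⟩
  refine ⟨hg, ?_⟩
  rw [div_lt_iff₀ hp0] at hn
  linarith

theorem LeftFinite.inv {a : HahnSeries Γ K} (ha : LeftFinite a) : LeftFinite a⁻¹ := by
  by_cases h0 : a = 0
  · simpa [h0] using leftFinite_zero
  set u : HahnSeries Γ K := HahnSeries.single (-a.order) (a.leadingCoeff⁻¹) with hu
  have hlc : a.leadingCoeff ≠ 0 := HahnSeries.leadingCoeff_ne_zero.mpr h0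
  have hu0 : u ≠ 0 := by
    rw [hu]
    exact HahnSeries.single_ne_zero (inv_ne_zero hlc)
  set w : HahnSeries Γ K := u * a with hw
  have hwL : LeftFinite w := (leftFinite_single _ _).mul ha
  have hw0 : w ≠ 0 := mul_ne_zero hu0 h0
  set y : HahnSeries Γ K := 1 - w with hy
  have hyL : LeftFinite y := by
    rw [hy, sub_eq_add_neg]
    exact (leftFinite_single 0 1).add hwL.neg
  have hpos : ∀ g ∈ y.support, (0 : ℝ) < (g : ℝ) := by
    intro g hg
    have hcoe : w.coeff g = a.leadingCoeff⁻¹ * a.coeff (g + a.order) := by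
      have := HahnSeries.coeff_single_mul_add (r := a.leadingCoeff⁻¹) (x := a)
        (a := g + a.order) (b := -a.order)
      simpa [hw, hu] using this
    by_contra hle
    have hle' : g ≤ 0 := by
      have : (g : ℝ) ≤ 0 := not_lt.mp hle
      exact_mod_cast this
    apply hg
    rcases hle'.lt_or_eq with h | h
    · have h1 : a.coeff (g + a.order) = 0 :=
        HahnSeries.coeff_eq_zero_of_lt_order (by simpa using h)
      simp [hy, hcoe, h1, HahnSeries.coeff_one, h.ne]
    · subst h
      simp only [hy, HahnSeries.coeff_sub, hcoe, zero_add, HahnSeries.coeff_one, if_true]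
      rw [← HahnSeries.leadingCoeff_eq, inv_mul_cancel₀ hlc, sub_self]
  have hp : ∃ p : ℝ, 0 < p ∧ ∀ g ∈ y.support, p ≤ (g : ℝ) := by
    by_cases hy0 : y = 0
    · exact ⟨1, one_pos, by simp [hy0]⟩
    · refine ⟨(y.order : ℝ), hpos _ ?_, fun g hg => ?_⟩
      · exact HahnSeries.coeff_order_eq_zero.not.mpr hy0
      · exact_mod_cast HahnSeries.order_le_of_coeff_ne_zero hg
  obtain ⟨p, hp0, hp⟩ := hp
  have hz : w⁻¹ = 1 + y * w⁻¹ := by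
    rw [hy, sub_mul, mul_inv_cancel₀ hw0]
    ring
  have hwi : LeftFinite w⁻¹ := leftFinite_of_pos hyL hp0 hp hz
  have : a⁻¹ = u * w⁻¹ := by
    rw [hw]
    field_simp
  rw [this]
  exact (leftFinite_single _ _).mul hwi

end Novikov

/-- The Novikov field `Λ^{K,Γ}`, with its power series addition and multiplication, as a subfield
of the field of Hahn series with exponents in `Γ ≤ ℝ` and coefficients in `K`. -/
def novikovSubfield (K : Type*) [Field K] (Γ : AddSubgroup ℝ) : Subfield (HahnSeries Γ K) where
  carrier := {a | Novikov.LeftFinite a}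
  mul_mem' := fun ha hb => Novikov.LeftFinite.mul ha hb
  one_mem' := Novikov.leftFinite_single 0 1
  add_mem' := fun ha hb => Novikov.LeftFinite.add ha hb
  zero_mem' := Novikov.leftFinite_zero
  neg_mem' := fun ha => Novikov.LeftFinite.neg ha
  inv_mem' := fun _ ha => Novikov.LeftFinite.inv ha

/-- The Novikov field `Λ^{K,Γ}` as a type. -/
abbrev NovikovField (K : Type*) [Field K] (Γ : AddSubgroup ℝ) : Type _ :=
  ↥(novikovSubfield K Γ)

/-- The valuation `ν(∑ a_g T^g) = min {g | a_g ≠ 0}` of a *nonzero* element. (It is only used for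
nonzero elements; the value at `0`, which should be `∞`, is never used.) -/
def NovikovField.val {K : Type*} [Field K] {Γ : AddSubgroup ℝ} (a : NovikovField K Γ) : ℝ :=
  ((a : HahnSeries Γ K).order : ℝ)

/-! ### Non-Archimedean normed vector spaces over the Novikov field -/

section Normed

variable {K : Type*} [Field K] {Γ : AddSubgroup ℝ}
variable {V : Type*} [AddCommGroup V] [Module (NovikovField K Γ) V]
variable {W : Type*} [AddCommGroup W] [Module (NovikovField K Γ) W]

/-- `ℓ : V → ℝ ∪ {-∞}` is a filtration function. (For the scalar `0` the rule
`ℓ (a • x) = ℓ x - ν a`, with `ν 0 = ∞`, says `ℓ 0 = -∞`, which is contained in `eq_bot_iff`.) -/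
structure IsFiltrationFunction (ℓ : V → WithBot ℝ) : Prop where
  eq_bot_iff : ∀ x, ℓ x = ⊥ ↔ x = 0
  smul : ∀ (a : NovikovField K Γ) (x : V), a ≠ 0 → ℓ (a • x) = ℓ x + ((-a.val : ℝ) : WithBot ℝ)
  add_le : ∀ x y, ℓ (x + y) ≤ max (ℓ x) (ℓ y)

/-- Orthogonality of a finite ordered collection: `ℓ (∑ aᵢ wᵢ) = maxᵢ ℓ (aᵢ wᵢ)` for all scalars
`aᵢ` (the maximum of the empty collection being `-∞`). -/
def IsOrthogonalFamily (ℓ : V → WithBot ℝ) {r : ℕ} (w : Fin r → V) : Prop :=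
  ∀ a : Fin r → NovikovField K Γ,
    ℓ (∑ i, a i • w i) = Finset.univ.sup fun i => ℓ (a i • w i)

variable (K Γ V) in
/-- `(V, ℓ)` is an orthogonalizable space over the Novikov field: a finite-dimensional
non-Archimedean normed vector space that has an orthogonal basis. -/
structure IsOrthogonalizable (ℓ : V → WithBot ℝ) : Prop where
  isFiltrationFunction : IsFiltrationFunction (K := K) (Γ := Γ) ℓ
  exists_basis : ∃ (n : ℕ) (b : Module.Basis (Fin n) (NovikovField K Γ) V),
    IsOrthogonalFamily (K := K) (Γ := Γ) ℓ b

/-- The real number `ℓ x`, for `x ≠ 0`. -/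
def realLevel {X : Type*} (ℓ : X → WithBot ℝ) (x : X) : ℝ := (ℓ x).unbotD 0

/-- A singular value decomposition `((y₁, …, yₙ), (x₁, …, xₘ))` of a linear map `A : V → W` of
rank `r`. (Positions are counted from `0`, so "`i ≤ r`" reads `i < r`. Subfamilies of
orthogonal families are orthogonal and those of bases are independent, so `span_ker` and
`span_range` say that `(y_{r+1}, …, yₙ)` is an orthogonal basis of `ker A` and `(x₁, …, x_r)` is one
of `im A`.) -/
structure SingularValueDecomposition (ℓV : V → WithBot ℝ) (ℓW : W → WithBot ℝ)
    (A : V →ₗ[NovikovField K Γ] W) where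
  n : ℕ
  m : ℕ
  y : Module.Basis (Fin n) (NovikovField K Γ) V
  x : Module.Basis (Fin m) (NovikovField K Γ) W
  y_orthogonal : IsOrthogonalFamily (K := K) (Γ := Γ) ℓV y
  x_orthogonal : IsOrthogonalFamily (K := K) (Γ := Γ) ℓW x
  span_ker : Submodule.span (NovikovField K Γ)
    (y '' {i | Module.finrank (NovikovField K Γ) (LinearMap.range A) ≤ i.1}) = LinearMap.ker A
  span_range : Submodule.span (NovikovField K Γ)
    (x '' {j | j.1 < Module.finrank (NovikovField K Γ) (LinearMap.range A)}) = LinearMap.range A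
  map_y : ∀ (i : Fin n) (j : Fin m), i.1 = j.1 →
    i.1 < Module.finrank (NovikovField K Γ) (LinearMap.range A) → A (y i) = x j
  sorted : ∀ (i i' : Fin n) (j j' : Fin m), i.1 = j.1 → i'.1 = j'.1 → i.1 ≤ i'.1 →
    i'.1 < Module.finrank (NovikovField K Γ) (LinearMap.range A) →
    realLevel ℓV (y i') - realLevel ℓW (x j') ≤ realLevel ℓV (y i) - realLevel ℓW (x j)

namespace SingularValueDecomposition

variable {ℓV : V → WithBot ℝ} {ℓW : W → WithBot ℝ} {A : V →ₗ[NovikovField K Γ] W}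

theorem rank_le (S : SingularValueDecomposition ℓV ℓW A) :
    Module.finrank (NovikovField K Γ) (LinearMap.range A) ≤ S.n := by
  have : Module.Finite (NovikovField K Γ) V := Module.Finite.of_basis S.y
  calc Module.finrank (NovikovField K Γ) (LinearMap.range A)
      ≤ Module.finrank (NovikovField K Γ) V := LinearMap.finrank_range_le A
    _ = S.n := by simp [Module.finrank_eq_card_basis S.y]

/-- The multiset in `(ℝ/Γ) × [0,∞]` consisting of the pairs `([ℓ xᵢ], ℓ yᵢ - ℓ xᵢ)` for `i ≤ r` and
`([ℓ xᵢ], ∞)` for `r < i ≤ m`. -/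
def verboseBarcode (S : SingularValueDecomposition ℓV ℓW A) : Multiset ((ℝ ⧸ Γ) × ℝ≥0∞) :=
  (Finset.univ : Finset (Fin S.m)).val.map fun j =>
    (QuotientAddGroup.mk (realLevel ℓW (S.x j)),
      if h : j.1 < Module.finrank (NovikovField K Γ) (LinearMap.range A) then
        ENNReal.ofReal
          (realLevel ℓV (S.y ⟨j.1, h.trans_le S.rank_le⟩) - realLevel ℓW (S.x j))
      else ⊤)

end SingularValueDecomposition

end Normed

/-! ### Floer-type complexes, their barcodes, and quasiequivalences -/

/-- A Floer-type complex over the Novikov field `Λ^{K,Γ}`: a `ℤ`-graded chain complex with a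
filtration function on each graded piece. -/
structure FloerComplex (K : Type u) [Field K] (Γ : AddSubgroup ℝ) where
  X : ChainComplex (ModuleCat.{v} (NovikovField K Γ)) ℤ
  ℓ : ∀ k : ℤ, X.X k → WithBot ℝ
  orthogonalizable : ∀ k : ℤ, IsOrthogonalizable K Γ (X.X k) (ℓ k)
  ℓ_d_le : ∀ (k : ℤ) (c : X.X k), ℓ (k - 1) ((X.d k (k - 1)).hom c) ≤ ℓ k c

namespace FloerComplex

variable {K : Type u} [Field K] {Γ : AddSubgroup ℝ}

/-- The space `Z_k = ker (∂_k : C_k → C_{k-1})` of degree-`k` cycles. -/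
def cycles (C : FloerComplex.{v} K Γ) (k : ℤ) : Submodule (NovikovField K Γ) (C.X.X k) :=
  LinearMap.ker (C.X.d k (k - 1)).hom

/-- The filtration function on `Z_k`. -/
def cyclesLevel (C : FloerComplex.{v} K Γ) (k : ℤ) (z : C.cycles k) : WithBot ℝ := C.ℓ k z.1

/-- The boundary map `∂_{k+1} : C_{k+1} → Z_k`. -/
def toCycles (C : FloerComplex.{v} K Γ) (k : ℤ) :
    C.X.X (k + 1) →ₗ[NovikovField K Γ] C.cycles k :=
  LinearMap.codRestrict (C.cycles k) (C.X.d (k + 1) k).hom fun c => by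
    rw [cycles, LinearMap.mem_ker, ← LinearMap.comp_apply, ← ModuleCat.hom_comp,
      C.X.d_comp_d]
    rfl

/-- `B` is the degree-`k` verbose barcode of `C`, computed from some singular value decomposition
of `∂_{k+1} : C_{k+1} → Z_k`. -/
def IsVerboseBarcode (C : FloerComplex.{v} K Γ) (k : ℤ) (B : Multiset ((ℝ ⧸ Γ) × ℝ≥0∞)) : Prop :=
  ∃ S : SingularValueDecomposition (C.ℓ (k + 1)) (C.cyclesLevel k) (C.toCycles k),
    B = S.verboseBarcode

open Classical in
/-- `B` is the degree-`k` concise barcode of `C`: the part of the verbose barcode that consists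
of the elements with positive second coordinate. -/
def IsConciseBarcode (C : FloerComplex.{v} K Γ) (k : ℤ) (B : Multiset ((ℝ ⧸ Γ) × ℝ≥0∞)) : Prop :=
  ∃ B₀, C.IsVerboseBarcode k B₀ ∧ B = B₀.filter fun p => 0 < p.2

/-- A `δ`-quasiequivalence `(Φ, Ψ, K_C, K_D)`. A Mathlib homotopy from `Ψ ∘ Φ` to the identity
is a family of maps `K : C_k → C_{k+1}` with `Ψ ∘ Φ - 1 = ∂ K + K ∂`. -/
structure Quasiequivalence (C D : FloerComplex.{v} K Γ) (δ : ℝ≥0) where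
  Φ : C.X ⟶ D.X
  Ψ : D.X ⟶ C.X
  KC : Homotopy (Φ ≫ Ψ) (𝟙 C.X)
  KD : Homotopy (Ψ ≫ Φ) (𝟙 D.X)
  Φ_le : ∀ (k : ℤ) (c : C.X.X k), D.ℓ k ((Φ.f k).hom c) ≤ C.ℓ k c + ((δ : ℝ) : WithBot ℝ)
  Ψ_le : ∀ (k : ℤ) (d : D.X.X k), C.ℓ k ((Ψ.f k).hom d) ≤ D.ℓ k d + ((δ : ℝ) : WithBot ℝ)
  KC_le : ∀ (k : ℤ) (c : C.X.X k),
    C.ℓ (k + 1) ((KC.hom k (k + 1)).hom c) ≤ C.ℓ k c + ((2 * δ : ℝ) : WithBot ℝ)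
  KD_le : ∀ (k : ℤ) (d : D.X.X k),
    D.ℓ (k + 1) ((KD.hom k (k + 1)).hom d) ≤ D.ℓ k d + ((2 * δ : ℝ) : WithBot ℝ)

/-- The quasiequivalence distance, in `[0,∞]` (it is `∞` if there is no quasiequivalence). -/
def dQ (C D : FloerComplex.{v} K Γ) : ℝ≥0∞ :=
  ⨅ (δ : ℝ≥0) (_ : Nonempty (Quasiequivalence C D δ)), (δ : ℝ≥0∞)

end FloerComplex

/-! ### Matchings and the bottleneck distance -/

namespace Barcode

variable {Γ : AddSubgroup ℝ}

/-- The condition that a `δ`-matching puts on a pair `p = ([a], L)`, `q = ([a'], L')` of matched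
elements: for all `ε > 0` the representative `a'` can be chosen so that `|a' - a| ≤ δ + ε` and
either `L = L' = ∞` or `|(a' + L') - (a + L)| ≤ δ + ε`. -/
def Matched (δ : ℝ≥0) (p q : (ℝ ⧸ Γ) × ℝ≥0∞) : Prop :=
  ∀ a : ℝ, (QuotientAddGroup.mk a : ℝ ⧸ Γ) = p.1 → ∀ ε : ℝ, 0 < ε →
    ∃ a' : ℝ, (QuotientAddGroup.mk a' : ℝ ⧸ Γ) = q.1 ∧ |a' - a| ≤ δ + ε ∧
      ((p.2 = ⊤ ∧ q.2 = ⊤) ∨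
        (p.2 ≠ ⊤ ∧ q.2 ≠ ⊤ ∧ |(a' + q.2.toReal) - (a + p.2.toReal)| ≤ δ + ε))

/-- There is a `δ`-matching between `S` and `T`: they split as `S = S_short + S'` and
`T = T_short + T'`, where the elements of `S_short` and `T_short` have length at most `2δ`, and there
is a bijection (of multisets) between `S'` and `T'` that relates matched elements. -/
def HasMatching (δ : ℝ≥0) (S T : Multiset ((ℝ ⧸ Γ) × ℝ≥0∞)) : Prop :=
  ∃ Sshort S' Tshort T' : Multiset ((ℝ ⧸ Γ) × ℝ≥0∞),
    S = Sshort + S' ∧ T = Tshort + T' ∧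
    (∀ p ∈ Sshort, p.2 ≤ 2 * (δ : ℝ≥0∞)) ∧ (∀ p ∈ Tshort, p.2 ≤ 2 * (δ : ℝ≥0∞)) ∧
    Multiset.Rel (Matched δ) S' T'

/-- The bottleneck distance of two multisets. -/
def dB (S T : Multiset ((ℝ ⧸ Γ) × ℝ≥0∞)) : ℝ≥0∞ :=
  ⨅ (δ : ℝ≥0) (_ : HasMatching δ S T), (δ : ℝ≥0∞)

/-- The bottleneck distance of two `ℤ`-indexed families of multisets. -/
def dBFamily (S T : ℤ → Multiset ((ℝ ⧸ Γ) × ℝ≥0∞)) : ℝ≥0∞ :=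
  ⨆ k : ℤ, dB (S k) (T k)

/-- The smallest second coordinate of the elements of `S` (`∞` if `S` is empty). -/
def minLength (S : Multiset ((ℝ ⧸ Γ) × ℝ≥0∞)) : ℝ≥0∞ := (S.map Prod.snd).inf

end Barcode

end

noncomputable section

/-! ### Valuations over the Novikov field and a matching criterion -/

namespace NovikovField

variable {K : Type*} [Field K] {Γ : AddSubgroup ℝ}

/-! Singular value decompositions come from Gaussian elimination with a well-chosen pivot
(`PartialDiagonalization.exists_insert`). Among all matrix entries that remain, the pivot is one for
which the map raises the filtration most; maximality along its column and along its row makes the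
two basis changes preserve orthogonality. The kernel of a map is then orthogonalizable too, so the
decomposition applies to `∂ : C_{k+1} → Z_k`.

For the upper bounds, a `δ`-quasiequivalence is shown to give a `δ`-matching in each degree, so that
`d_B ≤ d_Q` degree by degree; this yields both the factor 2 bound in (i) and the conclusion of (ii).
Write `Φ` on cycles as a matrix in the bases of bar starts. If the entry at `(j, i)` is nonzero,
with valuation `g`, then the `j`-th bar of `D` shifted down by `g` has both endpoints at most `δ`
above those of the `i`-th bar of `C`. If moreover its midpoint is not below that of the `i`-th bar,
both endpoints are within `δ`. Hence entries at pairs of bars that are not `δ`-close have valuation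
larger than the difference of midpoints (`valGT_of_not_related`). In the same weights, `ΨΦ - 1` is
small on the bars longer than `2δ`. Were Hall's condition to fail for these bars, a nonzero vector
would be annihilated by the rows of all `δ`-close bars and so be fixed by a matrix that strictly
increases the weighted valuation, which is impossible (`exists_injective_of_valGT`). This matches
the long bars of each side into the other side, and the Mendelsohn–Dulmage theorem
(`exists_biUnique_of_injective`) merges the two injections into one partial matching.

For the lower bound, the finishes of the finite bars in degree `k - 1` and the starts of the bars in
degree `k` form an orthogonal basis of `C_k`, which splits the complex into elementary summands. A
matching sends matched endpoints to each other, up to monomials `T^g`, and kills the rest. The two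
chain maps compose to projections onto the matched bars, and an unmatched bar is contracted by
sending its start to minus its finish, at the cost of its length (`exists_homotopy`,
`nonempty_quasiequivalence`). -/

theorem val_mul {a b : NovikovField K Γ} (ha : a ≠ 0) (hb : b ≠ 0) :
    NovikovField.val (a * b) = NovikovField.val a + NovikovField.val b := by
  have ha' : (a : HahnSeries Γ K) ≠ 0 := by simpa using ha
  have hb' : (b : HahnSeries Γ K) ≠ 0 := by simpa using hb
  simp [NovikovField.val, HahnSeries.order_mul ha' hb']

@[simp] theorem val_one : NovikovField.val (1 : NovikovField K Γ) = 0 := by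
  simp [NovikovField.val]

theorem val_neg (a : NovikovField K Γ) : NovikovField.val (-a) = NovikovField.val a := by
  simp [NovikovField.val]

theorem val_mem (a : NovikovField K Γ) : NovikovField.val a ∈ Γ :=
  (a : HahnSeries Γ K).order.2

theorem min_val_le_val_add {a b : NovikovField K Γ} (hab : a + b ≠ 0) :
    min (NovikovField.val a) (NovikovField.val b) ≤ NovikovField.val (a + b) := by
  have h : (a : HahnSeries Γ K) + b ≠ 0 := by
    intro h
    exact hab (Subtype.ext h)
  have := HahnSeries.min_order_le_order_add h
  simp only [NovikovField.val]
  exact_mod_cast this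

/-- The monomial `T^g`. -/
def monomial (K : Type*) [Field K] {Γ : AddSubgroup ℝ} (g : Γ) : NovikovField K Γ :=
  ⟨HahnSeries.single g 1, Novikov.leftFinite_single g 1⟩

theorem val_monomial (g : Γ) : NovikovField.val (monomial K g) = g := by
  simp [NovikovField.val, monomial, HahnSeries.order_single]

theorem monomial_mul (g h : Γ) : monomial K g * monomial K h = monomial K (g + h) := by
  apply Subtype.ext
  simp [monomial]

theorem monomial_zero : monomial K (0 : Γ) = 1 := rfl

/-- `ν a > c`, where `ν 0 = ∞`. -/
def ValGT (c : ℝ) (a : NovikovField K Γ) : Prop := a ≠ 0 → c < NovikovField.val a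

theorem ValGT.add {c : ℝ} {a b : NovikovField K Γ} (ha : ValGT c a) (hb : ValGT c b) :
    ValGT c (a + b) := by
  intro hab
  by_cases h1 : a = 0
  · subst h1
    simpa using hb (by simpa using hab)
  by_cases h2 : b = 0
  · subst h2
    simpa using ha h1
  exact (lt_min (ha h1) (hb h2)).trans_le (min_val_le_val_add hab)

theorem ValGT.neg {c : ℝ} {a : NovikovField K Γ} (ha : ValGT c a) : ValGT c (-a) := by
  intro h
  rw [val_neg]
  exact ha (by simpa using h)

theorem ValGT.sum {ι : Type*} {c : ℝ} {s : Finset ι} {f : ι → NovikovField K Γ}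
    (h : ∀ i ∈ s, ValGT c (f i)) : ValGT c (∑ i ∈ s, f i) :=
  Finset.sum_induction f (ValGT c) (fun _ _ => ValGT.add) (fun h => absurd rfl h) h

theorem ValGT.mul {c d e : ℝ} {a b : NovikovField K Γ} (ha : ValGT c a) (hb : ValGT d b)
    (he : e ≤ c + d) : ValGT e (a * b) := by
  intro hab
  have h1 := left_ne_zero_of_mul hab
  have h2 := right_ne_zero_of_mul hab
  rw [val_mul h1 h2]
  linarith [ha h1, hb h2]

/-- A nonzero vector is not a fixed point of a matrix that strictly increases the weighted
valuation `min (ν cᵢ - αᵢ)`. -/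
theorem eq_zero_of_eq_sum_of_valGT {ι : Type*} [Fintype ι] {α : ι → ℝ} {c : ι → NovikovField K Γ}
    {E : ι → ι → NovikovField K Γ} (hE : ∀ i i', ValGT (α i' - α i) (E i' i))
    (hc : ∀ i', c i' = ∑ i, E i' i * c i) : c = 0 := by
  classical
  by_contra h0
  obtain ⟨i₀, hi₀⟩ := Function.ne_iff.mp h0
  -- At an index `m` minimizing `ν cᵢ - αᵢ`, every nonzero term `E m i * c i` has valuation strictly
  -- above `ν c_m`, so their sum cannot be `c m`.
  obtain ⟨m, hm, hmin⟩ := Finset.exists_min_image (Finset.univ.filter fun i => c i ≠ 0)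
    (fun i => NovikovField.val (c i) - α i) ⟨i₀, by simpa using hi₀⟩
  have hm0 : c m ≠ 0 := by simpa using hm
  have : ValGT (NovikovField.val (c m)) (c m) := by
    have h : ValGT (NovikovField.val (c m)) (∑ i, E m i * c i) := by
      refine ValGT.sum fun i _ h => ?_
      have h1 := left_ne_zero_of_mul h
      have h2 := right_ne_zero_of_mul h
      rw [val_mul h1 h2]
      have := hmin i (by simpa using h2)
      have := hE i m h1
      linarith
    rwa [← hc m] at h
  exact lt_irrefl _ (this hm0)

/-- A matching criterion: if `ψ φ` is a small perturbation of the identity on the indices in `A`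
and the entries of `φ` and `ψ` at unrelated pairs of indices are small, then `A` can be matched into
`J` along the relation `R`. -/
theorem exists_injective_of_valGT {I J : Type*} [Fintype I] [Fintype J] [DecidableEq I] {α : I → ℝ} {β : J → ℝ}
    {φ : J → I → NovikovField K Γ} {ψ : I → J → NovikovField K Γ} {R : I → J → Prop} {A : Set I}
    (hφ : ∀ i j, ¬ R i j → ValGT (β j - α i) (φ j i))
    (hψ : ∀ i j, ¬ R i j → ValGT (α i - β j) (ψ i j))
    (hA : ∀ i ∈ A, ∀ i' ∈ A, ∃ κ, ValGT (α i' - α i) κ ∧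
      ∑ j, ψ i' j * φ j i = κ + (Pi.single i' 1 : I → NovikovField K Γ) i) :
    ∃ f : A → J, Function.Injective f ∧ ∀ i : A, R i (f i) := by
  classical
  -- Hall's marriage theorem. If the set `N` of neighbours of `B` is smaller than `B`, the block of
  -- `φ` with rows `N` and columns `B` has a nonzero kernel vector `c`.
  rw [← Fintype.all_card_le_filter_rel_iff_exists_injective (fun (i : A) j => R i j)]
  intro B
  set N : Finset J := Finset.univ.filter fun j => ∃ i ∈ B, R i j with hN
  by_contra! hlt
  let F : (B → NovikovField K Γ) →ₗ[NovikovField K Γ] (N → NovikovField K Γ) :=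
    Matrix.toLin' (Matrix.of fun j i => φ j.1 i.1.1)
  obtain ⟨c, hc, hc0⟩ : ∃ c, F c = 0 ∧ c ≠ 0 := by
    have := LinearMap.ker_ne_bot_of_finrank_lt (f := F) (by simpa using hlt)
    obtain ⟨c, hc, hc0⟩ := Submodule.exists_mem_ne_zero_of_ne_bot this
    exact ⟨c, hc, hc0⟩
  choose κ hκ hκ' using hA
  have hcj : ∀ j ∈ N, ∑ i : B, φ j i.1.1 * c i = 0 := by
    intro j hj
    have := congrFun hc ⟨j, hj⟩
    simpa [F, Matrix.mulVec, dotProduct] using this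
  apply hc0
  -- Since `φ c` vanishes on `N`, `c + κ c = ψ φ c` involves only indices outside `N`, and these are
  -- unrelated to all of `B`. So `c` is fixed by the matrix below, each entry of which is small; the
  -- weights `β` cancel in the products `ψ φ`.
  refine eq_zero_of_eq_sum_of_valGT (α := fun i : B => α i.1.1)
    (E := fun i' i => ∑ j ∈ Finset.univ.filter (· ∉ N), ψ i'.1.1 j * φ j i.1.1
      + -κ i.1.1 i.1.2 i'.1.1 i'.1.2) ?_ ?_
  · intro i i'
    refine ValGT.add (ValGT.sum fun j hj => ?_) (hκ _ _ _ _).neg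
    have hj' : ∀ i ∈ B, ¬ R i.1 j := by simpa [hN] using hj
    exact (hψ i'.1.1 j (hj' _ i'.2)).mul (hφ i.1.1 j (hj' _ i.2)) (by linarith)
  · intro i'
    have h1 : ∑ i : B, (∑ j, ψ i'.1.1 j * φ j i.1.1) * c i
        = ∑ i : B, κ i.1.1 i.1.2 i'.1.1 i'.1.2 * c i + c i' := by
      simp only [hκ' _ (Subtype.property _) _ (Subtype.property _), add_mul,
        Finset.sum_add_distrib]
      congr 1
      rw [Finset.sum_eq_single i']
      · simp
      · intro b _ hb
        have : b.1.1 ≠ i'.1.1 := fun h => hb (Subtype.ext (Subtype.ext h))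
        simp [this]
      · simp
    have h2 : ∑ i : B, (∑ j, ψ i'.1.1 j * φ j i.1.1) * c i
        = ∑ i : B, (∑ j ∈ Finset.univ.filter (· ∉ N), ψ i'.1.1 j * φ j i.1.1) * c i := by
      have h3 : ∀ s : Finset J, ∑ i : B, (∑ j ∈ s, ψ i'.1.1 j * φ j i.1.1) * c i
          = ∑ j ∈ s, ψ i'.1.1 j * ∑ i : B, φ j i.1.1 * c i := by
        intro s
        simp only [Finset.sum_mul, Finset.mul_sum, mul_assoc]
        exact Finset.sum_comm
      rw [h3, h3, ← Finset.sum_filter_add_sum_filter_not _ (· ∉ N), add_eq_left]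
      refine Finset.sum_eq_zero fun j hj => ?_
      rw [hcj j (by simpa using hj), mul_zero]
    simp only [add_mul, Finset.sum_add_distrib, neg_mul, Finset.sum_neg_distrib]
    rw [← h2, h1]
    ring

end NovikovField

/-! ### Partial matchings -/

section Combinatorics

variable {I J : Type*}

/-- The points reached by alternating `f` and `g`, starting from the points of `A` that are not in
the range of `g`. -/
inductive AlternatingReach {A : Set I} {B : Set J} (f : A → J) (g : B → I) : I → Prop
  | base (i : I) (hi : i ∈ A) (h : ∀ j, g j ≠ i) : AlternatingReach f g i
  | step (i : A) (hi : AlternatingReach f g i) (h : f i ∈ B) : AlternatingReach f g (g ⟨f i, h⟩)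

/-- The Mendelsohn–Dulmage theorem: if `A` can be matched into `J` and `B` can be matched into `I`,
there is a matching that covers both `A` and `B`. -/
theorem exists_biUnique_of_injective {A : Set I} {B : Set J} {R : I → J → Prop}
    {f : A → J} {g : B → I} (hf : Function.Injective f) (hg : Function.Injective g)
    (hfR : ∀ i : A, R i (f i)) (hgR : ∀ j : B, R (g j) j) :
    ∃ M : I → J → Prop, Relator.BiUnique M ∧ (∀ i j, M i j → R i j) ∧
      (∀ i ∈ A, ∃ j, M i j) ∧ ∀ j ∈ B, ∃ i, M i j := by
  -- Points on alternating paths that start outside the range of `g` are matched by `f`, all others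
  -- by `g`. The paths are closed under following `f` and then `g`, so the two rules never compete
  -- for the same `j`.
  let S := AlternatingReach f g
  refine ⟨fun i j => (∃ h : i ∈ A, S i ∧ f ⟨i, h⟩ = j) ∨ (∃ h : j ∈ B, ¬ S i ∧ g ⟨j, h⟩ = i),
    ⟨?_, ?_⟩, ?_, ?_, ?_⟩
  · rintro i i' j (⟨hi, hS, rfl⟩ | ⟨hj, hS, rfl⟩) (⟨hi', hS', h⟩ | ⟨hj', hS', h⟩)
    · exact (congrArg Subtype.val (hf h)).symm
    · exact absurd (h ▸ AlternatingReach.step ⟨i, hi⟩ hS hj') hS'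
    · subst h
      exact absurd (AlternatingReach.step ⟨i', hi'⟩ hS' hj) hS
    · exact h
  · rintro i j j' (⟨hi, hS, rfl⟩ | ⟨hj, hS, rfl⟩) (⟨hi', hS', h⟩ | ⟨hj', hS', h⟩)
    · exact h
    · exact absurd hS hS'
    · exact absurd hS' hS
    · exact (congrArg Subtype.val (hg h)).symm
  · rintro i j (⟨hi, -, rfl⟩ | ⟨hj, -, rfl⟩)
    · exact hfR ⟨i, hi⟩
    · exact hgR ⟨j, hj⟩
  · intro i hi
    by_cases hS : S i
    · exact ⟨_, Or.inl ⟨hi, hS, rfl⟩⟩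
    · by_cases h : ∃ j, g j = i
      · obtain ⟨j, hj⟩ := h
        exact ⟨j, Or.inr ⟨j.2, hS, hj⟩⟩
      · exact absurd (AlternatingReach.base i hi fun j hj => h ⟨j, hj⟩) hS
  · intro j hj
    by_cases hS : S (g ⟨j, hj⟩)
    · generalize hi : g ⟨j, hj⟩ = i at hS
      cases hS with
      | base i hA h => exact absurd hi (h _)
      | step i hS h =>
        have := congrArg Subtype.val (hg hi)
        exact ⟨i, Or.inl ⟨i.2, hS, this.symm⟩⟩
    · exact ⟨_, Or.inr ⟨hj, hS, rfl⟩⟩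

/-- Lifts a splitting of a barcode to its index set, where distinct bars with equal values can be
told apart. -/
theorem Multiset.exists_add_of_map_eq_add {f : I → J} {s : Multiset I} {t₁ t₂ : Multiset J}
    (h : s.map f = t₁ + t₂) : ∃ s₁ s₂, s = s₁ + s₂ ∧ s₁.map f = t₁ ∧ s₂.map f = t₂ := by
  classical
  induction t₁ using Multiset.induction_on generalizing s with
  | empty => exact ⟨0, s, by simp, rfl, by simpa using h⟩
  | cons b t ih =>
    rw [Multiset.cons_add] at h
    obtain ⟨a, ha, rfl, h'⟩ := (Multiset.map_eq_cons f s _ b).mpr h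
    obtain ⟨s₁, s₂, hs, rfl, rfl⟩ := ih h'
    refine ⟨a ::ₘ s₁, s₂, ?_, by simp, rfl⟩
    rw [Multiset.cons_add, ← hs, Multiset.cons_erase ha]

theorem Multiset.exists_of_rel {r : I → J → Prop} {s : Multiset I} {t : Multiset J}
    (h : Multiset.Rel r s t) :
    ∃ u : Multiset (I × J), u.map Prod.fst = s ∧ u.map Prod.snd = t ∧ ∀ x ∈ u, r x.1 x.2 := by
  induction h with
  | zero => exact ⟨0, by simp⟩
  | @cons a b _ _ hab _ ih =>
    obtain ⟨u, rfl, rfl, hu⟩ := ih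
    exact ⟨(a, b) ::ₘ u, by simp, by simp, by simpa using ⟨hab, fun a b => hu (a, b)⟩⟩

end Combinatorics

/-! ### Matchings of multisets and matchings of index sets -/

namespace Barcode

variable {Γ : AddSubgroup ℝ} {I J : Type*} [Fintype I] [Fintype J]

open Classical in
/-- A matching between index sets of two verbose barcodes that covers the long bars induces a
`δ`-matching of the concise barcodes. -/
theorem hasMatching_of_biUnique {δ : ℝ≥0} {p : I → (ℝ ⧸ Γ) × ℝ≥0∞} {q : J → (ℝ ⧸ Γ) × ℝ≥0∞}
    {M : I → J → Prop} (hM : Relator.BiUnique M) (hMm : ∀ i j, M i j → Matched δ (p i) (q j))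
    (hpos : ∀ i j, M i j → 0 < (p i).2 ∧ 0 < (q j).2)
    (hI : ∀ i, (¬ ∃ j, M i j) → (p i).2 ≤ 2 * (δ : ℝ≥0∞))
    (hJ : ∀ j, (¬ ∃ i, M i j) → (q j).2 ≤ 2 * (δ : ℝ≥0∞)) :
    HasMatching δ (((Finset.univ : Finset I).val.map p).filter fun x => 0 < x.2)
      (((Finset.univ : Finset J).val.map q).filter fun x => 0 < x.2) := by
  set s := Finset.univ.filter fun i => 0 < (p i).2 with hs
  set t := Finset.univ.filter fun j => 0 < (q j).2 with ht
  set U : Finset (I × J) := Finset.univ.filter fun x => M x.1 x.2 with hU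
  have hU1 : U.val.map Prod.fst = (s.filter fun i => ∃ j, M i j).val := by
    rw [← Finset.image_val_of_injOn]
    · congr 1
      ext i
      simp only [hU, hs, Finset.mem_image, Finset.mem_filter, Finset.mem_univ, true_and]
      constructor
      · rintro ⟨⟨a, b⟩, h, rfl⟩
        exact ⟨(hpos _ _ h).1, b, h⟩
      · rintro ⟨-, j, h⟩
        exact ⟨(i, j), h, rfl⟩
    · rintro ⟨a, b⟩ h ⟨a', b'⟩ h' (rfl : a = a')
      have h1 : M a b := by simpa [hU] using h
      have h2 : M a b' := by simpa [hU] using h'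
      rw [hM.2 h1 h2]
  have hU2 : U.val.map Prod.snd = (t.filter fun j => ∃ i, M i j).val := by
    rw [← Finset.image_val_of_injOn]
    · congr 1
      ext j
      simp only [hU, ht, Finset.mem_image, Finset.mem_filter, Finset.mem_univ, true_and]
      constructor
      · rintro ⟨⟨a, b⟩, h, rfl⟩
        exact ⟨(hpos _ _ h).2, a, h⟩
      · rintro ⟨-, i, h⟩
        exact ⟨(i, j), h, rfl⟩
    · rintro ⟨a, b⟩ h ⟨a', b'⟩ h' (rfl : b = b')
      have h1 : M a b := by simpa [hU] using h
      have h2 : M a' b := by simpa [hU] using h'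
      rw [hM.1 h1 h2]
  refine ⟨(s.filter fun i => ¬ ∃ j, M i j).val.map p, (s.filter fun i => ∃ j, M i j).val.map p,
    (t.filter fun j => ¬ ∃ i, M i j).val.map q, (t.filter fun j => ∃ i, M i j).val.map q,
    ?_, ?_, ?_, ?_, ?_⟩
  · rw [Multiset.filter_map, ← Multiset.map_add, add_comm, Finset.filter_val _ s,
      Finset.filter_val _ s, Multiset.filter_add_not]
    rfl
  · rw [Multiset.filter_map, ← Multiset.map_add, add_comm, Finset.filter_val _ t,
      Finset.filter_val _ t, Multiset.filter_add_not]
    rfl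
  · intro x hx
    obtain ⟨i, hi, rfl⟩ := Multiset.mem_map.mp hx
    exact hI i (Finset.mem_filter.mp hi).2
  · intro x hx
    obtain ⟨j, hj, rfl⟩ := Multiset.mem_map.mp hx
    exact hJ j (Finset.mem_filter.mp hj).2
  · rw [Multiset.rel_map, ← hU1, ← hU2, Multiset.rel_map]
    exact Multiset.rel_refl_of_refl_on fun x hx => hMm _ _ (Finset.mem_filter.mp hx).2

open Classical in
/-- A `δ`-matching of concise barcodes comes from a matching between the index sets of the verbose
barcodes. -/
theorem HasMatching.exists_biUnique {δ : ℝ≥0} {p : I → (ℝ ⧸ Γ) × ℝ≥0∞}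
    {q : J → (ℝ ⧸ Γ) × ℝ≥0∞}
    (h : HasMatching δ (((Finset.univ : Finset I).val.map p).filter fun x => 0 < x.2)
      (((Finset.univ : Finset J).val.map q).filter fun x => 0 < x.2)) :
    ∃ M : I → J → Prop, Relator.BiUnique M ∧ (∀ i j, M i j → Matched δ (p i) (q j)) ∧
      (∀ i, (¬ ∃ j, M i j) → (p i).2 ≤ 2 * (δ : ℝ≥0∞)) ∧
      (∀ j, (¬ ∃ i, M i j) → (q j).2 ≤ 2 * (δ : ℝ≥0∞)) := by
  obtain ⟨Ss, S', Ts, T', hS, hT, hSs, hTs, hrel⟩ := h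
  rw [Multiset.filter_map] at hS hT
  obtain ⟨s₁, s₂, hs, rfl, rfl⟩ := Multiset.exists_add_of_map_eq_add hS
  obtain ⟨t₁, t₂, ht, rfl, rfl⟩ := Multiset.exists_add_of_map_eq_add hT
  rw [Multiset.rel_map] at hrel
  obtain ⟨U, rfl, rfl, hU⟩ := Multiset.exists_of_rel hrel
  -- Each index occurs only once in the index multiset, so a pair in `U` is determined by either of
  -- its components.
  have hs' := (Multiset.nodup_add.mp (hs ▸ Finset.univ.nodup.filter _)).2.1
  have ht' := (Multiset.nodup_add.mp (ht ▸ Finset.univ.nodup.filter _)).2.1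
  refine ⟨fun i j => (i, j) ∈ U, ⟨?_, ?_⟩, fun i j hij => hU _ hij, ?_, ?_⟩
  · intro i i' j h h'
    exact congrArg Prod.fst (Multiset.inj_on_of_nodup_map ht' _ h _ h' rfl)
  · intro i j j' h h'
    exact congrArg Prod.snd (Multiset.inj_on_of_nodup_map hs' _ h _ h' rfl)
  · intro i hi
    by_cases h0 : 0 < (p i).2
    · have : i ∈ s₁ + U.map Prod.fst := by
        rw [← hs]
        exact Multiset.mem_filter.mpr ⟨Finset.mem_univ i, h0⟩
      rcases Multiset.mem_add.mp this with h | h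
      · exact hSs _ (Multiset.mem_map_of_mem _ h)
      · obtain ⟨⟨a, b⟩, hx, rfl⟩ := Multiset.mem_map.mp h
        exact absurd ⟨b, hx⟩ hi
    · simp [nonpos_iff_eq_zero.mp (not_lt.mp h0)]
  · intro j hj
    by_cases h0 : 0 < (q j).2
    · have : j ∈ t₁ + U.map Prod.snd := by
        rw [← ht]
        exact Multiset.mem_filter.mpr ⟨Finset.mem_univ j, h0⟩
      rcases Multiset.mem_add.mp this with h | h
      · exact hTs _ (Multiset.mem_map_of_mem _ h)
      · obtain ⟨⟨a, b⟩, hx, rfl⟩ := Multiset.mem_map.mp h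
        exact absurd ⟨a, hx⟩ hj
    · simp [nonpos_iff_eq_zero.mp (not_lt.mp h0)]

end Barcode

/-! ### Filtration functions and orthogonal bases -/

section Filtration

variable {K : Type*} [Field K] {Γ : AddSubgroup ℝ}
variable {V : Type*} [AddCommGroup V] [Module (NovikovField K Γ) V] {ℓ : V → WithBot ℝ}
variable {W : Type*} [AddCommGroup W] [Module (NovikovField K Γ) W] {ℓW : W → WithBot ℝ}
variable {ι : Type*} [Fintype ι]

namespace IsFiltrationFunction

theorem map_zero (h : IsFiltrationFunction (K := K) (Γ := Γ) ℓ) : ℓ 0 = ⊥ :=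
  (h.eq_bot_iff 0).mpr rfl

theorem map_neg (h : IsFiltrationFunction (K := K) (Γ := Γ) ℓ) (x : V) : ℓ (-x) = ℓ x := by
  have := h.smul (-1) x (by simp)
  rw [NovikovField.val_neg] at this
  simpa using this

theorem sub_le (h : IsFiltrationFunction (K := K) (Γ := Γ) ℓ) (x y : V) :
    ℓ (x - y) ≤ max (ℓ x) (ℓ y) := by
  rw [sub_eq_add_neg, ← h.map_neg y]
  exact h.add_le _ _

theorem sum_le (h : IsFiltrationFunction (K := K) (Γ := Γ) ℓ) {κ : Type*} {s : Finset κ}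
    {f : κ → V} {c : WithBot ℝ} (hf : ∀ i ∈ s, ℓ (f i) ≤ c) : ℓ (∑ i ∈ s, f i) ≤ c :=
  Finset.sum_induction f (ℓ · ≤ c) (fun _ _ hx hy => (h.add_le _ _).trans (max_le hx hy))
    (by simp [h.map_zero]) hf

theorem coe_realLevel (h : IsFiltrationFunction (K := K) (Γ := Γ) ℓ) {x : V} (hx : x ≠ 0) :
    ((realLevel ℓ x : ℝ) : WithBot ℝ) = ℓ x := by
  have h0 : ℓ x ≠ ⊥ := fun h0 => hx ((h.eq_bot_iff x).mp h0)
  obtain ⟨r, hr⟩ := WithBot.ne_bot_iff_exists.mp h0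
  simp [realLevel, ← hr]

theorem realLevel_smul (h : IsFiltrationFunction (K := K) (Γ := Γ) ℓ) {a : NovikovField K Γ}
    {x : V} (ha : a ≠ 0) (hx : x ≠ 0) :
    realLevel ℓ (a • x) = realLevel ℓ x - NovikovField.val a := by
  have h1 := h.smul a x ha
  rw [← h.coe_realLevel hx, ← h.coe_realLevel (smul_ne_zero ha hx), ← WithBot.coe_add] at h1
  have := WithBot.coe_injective h1
  linarith

theorem smul_le_coe_iff (h : IsFiltrationFunction (K := K) (Γ := Γ) ℓ) {a : NovikovField K Γ}
    {x : V} (hx : x ≠ 0) {c : ℝ} :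
    ℓ (a • x) ≤ (c : WithBot ℝ) ↔ (a ≠ 0 → realLevel ℓ x - NovikovField.val a ≤ c) := by
  by_cases ha : a = 0
  · simp [ha, h.map_zero]
  · rw [← h.coe_realLevel (smul_ne_zero ha hx), WithBot.coe_le_coe, h.realLevel_smul ha hx]
    simp [ha]

theorem smul_le_smul_add (h : IsFiltrationFunction (K := K) (Γ := Γ) ℓ)
    (hW : IsFiltrationFunction (K := K) (Γ := Γ) ℓW) {x : V} {y : W} {d : WithBot ℝ}
    (hxy : ℓ x ≤ ℓW y + d) (a : NovikovField K Γ) : ℓ (a • x) ≤ ℓW (a • y) + d := by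
  by_cases ha : a = 0
  · simp [ha, h.map_zero]
  · rw [h.smul a x ha, hW.smul a y ha, add_right_comm]
    gcongr

theorem smul_le_smul (h : IsFiltrationFunction (K := K) (Γ := Γ) ℓ) {x y : V} (hxy : ℓ x ≤ ℓ y)
    (a : NovikovField K Γ) : ℓ (a • x) ≤ ℓ (a • y) := by
  simpa using h.smul_le_smul_add h (d := 0) (by simpa using hxy) a

end IsFiltrationFunction

variable (K Γ) in
/-- An orthogonal basis, indexed by an arbitrary finite type. -/
structure IsOrthogonalBasis (ℓ : V → WithBot ℝ) (w : ι → V) : Prop where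
  smul_le : ∀ (a : ι → NovikovField K Γ) (i : ι), ℓ (a i • w i) ≤ ℓ (∑ i, a i • w i)
  ne_zero : ∀ i, w i ≠ 0
  span : ⊤ ≤ Submodule.span (NovikovField K Γ) (Set.range w)

namespace IsFiltrationFunction

theorem isOrthogonalFamily_iff (h : IsFiltrationFunction (K := K) (Γ := Γ) ℓ) {r : ℕ}
    {w : Fin r → V} : IsOrthogonalFamily (K := K) (Γ := Γ) ℓ w ↔
      ∀ (a : Fin r → NovikovField K Γ) (i : Fin r), ℓ (a i • w i) ≤ ℓ (∑ i, a i • w i) := by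
  refine ⟨fun hw a i => ?_, fun hw a => le_antisymm ?_ ?_⟩
  · rw [hw a]
    exact Finset.le_sup (f := fun i => ℓ (a i • w i)) (Finset.mem_univ i)
  · exact h.sum_le fun i hi => Finset.le_sup (f := fun i => ℓ (a i • w i)) hi
  · exact Finset.sup_le fun i _ => hw a i

theorem isOrthogonalBasis (h : IsFiltrationFunction (K := K) (Γ := Γ) ℓ) {r : ℕ}
    {w : Module.Basis (Fin r) (NovikovField K Γ) V}
    (hw : IsOrthogonalFamily (K := K) (Γ := Γ) ℓ w) : IsOrthogonalBasis K Γ ℓ w :=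
  ⟨h.isOrthogonalFamily_iff.mp hw, w.ne_zero, w.span_eq.ge⟩

theorem linearIndependent (h : IsFiltrationFunction (K := K) (Γ := Γ) ℓ) {w : ι → V}
    (hw : ∀ (a : ι → NovikovField K Γ) (i : ι), ℓ (a i • w i) ≤ ℓ (∑ i, a i • w i))
    (h0 : ∀ i, w i ≠ 0) : LinearIndependent (NovikovField K Γ) w := by
  rw [Fintype.linearIndependent_iff]
  intro a ha i
  have := hw a i
  rw [ha, h.map_zero, le_bot_iff, h.eq_bot_iff] at this
  exact (smul_eq_zero.mp this).resolve_right (h0 i)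

end IsFiltrationFunction

namespace IsOrthogonalBasis

/-- Orthogonal nonzero vectors are independent, so spanning follows from counting them against the
reference basis `b`. -/
theorem of_card (h : IsFiltrationFunction (K := K) (Γ := Γ) ℓ) {w : ι → V}
    (hw : ∀ (a : ι → NovikovField K Γ) (i : ι), ℓ (a i • w i) ≤ ℓ (∑ i, a i • w i))
    (h0 : ∀ i, w i ≠ 0) (b : Module.Basis ι (NovikovField K Γ) V) :
    IsOrthogonalBasis K Γ ℓ w := by
  have : Module.Finite (NovikovField K Γ) V := Module.Finite.of_basis b
  refine ⟨hw, h0, ?_⟩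
  rw [(h.linearIndependent hw h0).span_eq_top_of_card_eq_finrank'
    (Module.finrank_eq_card_basis b).symm]

variable {w : ι → V}

/-- The underlying basis. -/
def basis (hw : IsOrthogonalBasis K Γ ℓ w) (h : IsFiltrationFunction (K := K) (Γ := Γ) ℓ) :
    Module.Basis ι (NovikovField K Γ) V :=
  Module.Basis.mk (h.linearIndependent hw.smul_le hw.ne_zero) hw.span

theorem basis_apply (hw : IsOrthogonalBasis K Γ ℓ w)
    (h : IsFiltrationFunction (K := K) (Γ := Γ) ℓ) (i : ι) : hw.basis h i = w i := by
  simp [basis]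

theorem coe_basis (hw : IsOrthogonalBasis K Γ ℓ w)
    (h : IsFiltrationFunction (K := K) (Γ := Γ) ℓ) : ⇑(hw.basis h) = w :=
  funext (hw.basis_apply h)

theorem sum_repr (hw : IsOrthogonalBasis K Γ ℓ w)
    (h : IsFiltrationFunction (K := K) (Γ := Γ) ℓ) (x : V) :
    ∑ i, (hw.basis h).repr x i • w i = x := by
  have := (hw.basis h).sum_repr x
  rwa [hw.coe_basis h] at this

theorem repr_smul_le (hw : IsOrthogonalBasis K Γ ℓ w)
    (h : IsFiltrationFunction (K := K) (Γ := Γ) ℓ) (x : V) (i : ι) :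
    ℓ ((hw.basis h).repr x i • w i) ≤ ℓ x := by
  have := hw.smul_le (fun i => (hw.basis h).repr x i) i
  rwa [hw.sum_repr h] at this

/-- A linear map shifts the filtration by at most `d` if it does so on an orthogonal basis. -/
theorem map_le (hw : IsOrthogonalBasis K Γ ℓ w) (h : IsFiltrationFunction (K := K) (Γ := Γ) ℓ)
    (hW : IsFiltrationFunction (K := K) (Γ := Γ) ℓW) (T : V →ₗ[NovikovField K Γ] W)
    {d : WithBot ℝ} (hT : ∀ i, ℓW (T (w i)) ≤ ℓ (w i) + d) (x : V) : ℓW (T x) ≤ ℓ x + d := by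
  conv_lhs => rw [← hw.sum_repr h x, map_sum]
  refine hW.sum_le fun i _ => ?_
  rw [map_smul]
  refine (hW.smul_le_smul_add h (hT i) _).trans ?_
  gcongr
  exact hw.repr_smul_le h x i

/-- The hypothesis says that the `i`-th component is a dominant term of `x`. In a combination of the
new vectors only `x` contributes to the `i`-th coordinate, which therefore bounds the `x`-term; the
other terms are then bounded after subtracting it. -/
theorem update [DecidableEq ι] (hw : IsOrthogonalBasis K Γ ℓ w)
    (h : IsFiltrationFunction (K := K) (Γ := Γ) ℓ) {i : ι} {x : V} (hx : x ≠ 0)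
    (hxi : ℓ x ≤ ℓ ((hw.basis h).repr x i • w i)) :
    IsOrthogonalBasis K Γ ℓ (Function.update w i x) := by
  refine of_card h (fun a => ?_) (fun k => ?_) (hw.basis h)
  · have htot : ∑ k, a k • Function.update w i x k
        = a i • x + ∑ k, Function.update a i 0 k • w k := by
      rw [← Finset.add_sum_erase _ _ (Finset.mem_univ i),
        ← Finset.add_sum_erase _ (fun k => Function.update a i 0 k • w k) (Finset.mem_univ i)]
      simp only [Function.update_self, zero_smul, zero_add]
      congr 1
      refine Finset.sum_congr rfl fun k hk => ?_
      rw [Function.update_of_ne (Finset.ne_of_mem_erase hk),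
        Function.update_of_ne (Finset.ne_of_mem_erase hk)]
    have hi : ℓ (a i • x) ≤ ℓ (∑ k, a k • Function.update w i x k) := by
      refine le_trans ?_ (hw.repr_smul_le h _ i)
      have : (hw.basis h).repr (∑ k, a k • Function.update w i x k) i
          = a i * (hw.basis h).repr x i := by
        rw [htot]
        have := (hw.basis h).repr_sum_self (Function.update a i 0)
        rw [hw.coe_basis h] at this
        rw [map_add, Finsupp.add_apply, this]
        simp
      rw [this, mul_smul]
      exact h.smul_le_smul hxi _
    intro k
    by_cases hk : k = i
    · subst hk
      simpa using hi
    · rw [Function.update_of_ne hk]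
      have h1 := hw.smul_le (Function.update a i 0) k
      rw [Function.update_of_ne hk] at h1
      refine h1.trans ?_
      have h2 : ∑ k, Function.update a i 0 k • w k
          = ∑ k, a k • Function.update w i x k - a i • x := by rw [htot]; abel
      rw [h2]
      exact (h.sub_le _ _).trans (max_le le_rfl hi)
  · by_cases hk : k = i
    · subst hk
      simpa using hx
    · rw [Function.update_of_ne hk]
      exact hw.ne_zero k

/-- For `k ≠ j` the `k`-th coordinate of a combination is unaffected by the change, and `wₖ - cₖ wⱼ`
is no higher than `wₖ`. The `j`-th term is what remains after subtracting all the others. -/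
theorem sub_smul (hw : IsOrthogonalBasis K Γ ℓ w)
    (h : IsFiltrationFunction (K := K) (Γ := Γ) ℓ) {j : ι} {c : ι → NovikovField K Γ}
    (hj : c j = 0) (hc : ∀ k, ℓ (c k • w j) ≤ ℓ (w k)) :
    IsOrthogonalBasis K Γ ℓ fun k => w k - c k • w j := by
  classical
  have hrepr : ∀ k l, (hw.basis h).repr (w k) l = if k = l then 1 else 0 := by
    intro k l
    have := (hw.basis h).repr_self_apply k l
    rwa [hw.basis_apply] at this
  refine of_card h (fun a => ?_) (fun k h0 => ?_) (hw.basis h)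
  · have hk : ∀ k, k ≠ j → ℓ (a k • (w k - c k • w j)) ≤ ℓ (∑ k, a k • (w k - c k • w j)) := by
      intro k hk
      have h1 : (hw.basis h).repr (∑ k, a k • (w k - c k • w j)) k = a k := by
        simp [hrepr, hk.symm, Finsupp.finsetSum_apply]
      have h2 := hw.repr_smul_le h (∑ k, a k • (w k - c k • w j)) k
      rw [h1] at h2
      refine le_trans (h.smul_le_smul ?_ _) h2
      exact (h.sub_le _ _).trans (max_le le_rfl (hc k))
    intro k
    by_cases hkj : k = j
    · subst hkj
      have : a k • (w k - c k • w k) = ∑ l, a l • (w l - c l • w k)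
          - ∑ l ∈ Finset.univ.erase k, a l • (w l - c l • w k) := by
        rw [← Finset.add_sum_erase _ _ (Finset.mem_univ k)]
        abel
      rw [this]
      exact (h.sub_le _ _).trans (max_le le_rfl
        (h.sum_le fun l hl => hk l (Finset.ne_of_mem_erase hl)))
    · exact hk k hkj
  · have := congrArg (fun x => (hw.basis h).repr x k) h0
    by_cases hkj : k = j
    · subst hkj
      simp [hrepr, hj] at this
    · simp [hrepr, Ne.symm hkj] at this

end IsOrthogonalBasis

end Filtration

/-! ### Existence of singular value decompositions -/

section Existence

variable {K : Type*} [Field K] {Γ : AddSubgroup ℝ}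
variable {V : Type*} [AddCommGroup V] [Module (NovikovField K Γ) V] {ℓV : V → WithBot ℝ}
variable {W : Type*} [AddCommGroup W] [Module (NovikovField K Γ) W] {ℓW : W → WithBot ℝ}

/-- Orthogonal bases of the source and target of `A`, part of which has already been put into
normal form: `A vₛ = w_{f s}` for `s ∈ S`, and the remaining basis vectors `vₖ` are mapped into the
span of the remaining basis vectors of the target. -/
structure PartialDiagonalization {ι κ : Type*} [Fintype ι] [Fintype κ] (ℓV : V → WithBot ℝ)
    (ℓW : W → WithBot ℝ) (A : V →ₗ[NovikovField K Γ] W) (S : Finset ι) where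
  f : ι → κ
  v : ι → V
  w : κ → W
  v_basis : IsOrthogonalBasis K Γ ℓV v
  w_basis : IsOrthogonalBasis K Γ ℓW w
  injOn : Set.InjOn f S
  map_of_mem : ∀ s ∈ S, A (v s) = w (f s)
  map_of_notMem : ∀ k ∉ S, A (v k) ∈ Submodule.span (NovikovField K Γ) (w '' (f '' S)ᶜ)

/-- One step of Gaussian elimination. The pivot maximizes the amount by which `A` raises the
filtration. -/
theorem PartialDiagonalization.exists_insert {ι κ : Type*} [Fintype ι] [Fintype κ]
    (hV : IsFiltrationFunction (K := K) (Γ := Γ) ℓV)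
    (hW : IsFiltrationFunction (K := K) (Γ := Γ) ℓW) {A : V →ₗ[NovikovField K Γ] W} {S : Finset ι}
    (P : PartialDiagonalization (κ := κ) ℓV ℓW A S) (hP : ∃ k ∉ S, A (P.v k) ≠ 0) :
    ∃ j ∉ S, ∃ S' : Finset ι, S ⊆ S' ∧ j ∈ S' ∧
      Nonempty (PartialDiagonalization (κ := κ) ℓV ℓW A S') := by
  classical
  obtain ⟨f, v, w, hv, hw, hf, hS, hS'⟩ := P
  dsimp only at hP
  set a : κ → ι → NovikovField K Γ := fun i j => (hw.basis hW).repr (A (v j)) i with ha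
  have hsum : ∀ j, A (v j) = ∑ i, a i j • w i := fun j => (hw.sum_repr hW _).symm
  have haf : ∀ i j, j ∉ S → a i j ≠ 0 → i ∉ f '' S := by
    intro i j hj hij
    have h1 := hS' j hj
    rw [← hw.coe_basis hW, Module.Basis.mem_span_image] at h1
    exact h1 (by simpa using hij)
  obtain ⟨⟨j, i⟩, hji, hmax⟩ := Finset.exists_max_image
    (Finset.univ.filter fun x : ι × κ => x.1 ∉ S ∧ a x.2 x.1 ≠ 0)
    (fun x => realLevel ℓW (a x.2 x.1 • w x.2) - realLevel ℓV (v x.1)) (by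
      obtain ⟨k, hk, hk0⟩ := hP
      obtain ⟨i, hi⟩ : ∃ i, a i k ≠ 0 := by
        by_contra! h
        apply hk0
        rw [hsum]
        simp [h]
      exact ⟨(k, i), by simp [hk, hi]⟩)
  obtain ⟨hj, hij⟩ : j ∉ S ∧ a i j ≠ 0 := by simpa using hji
  have hmax' : ∀ k l, k ∉ S → a l k ≠ 0 → realLevel ℓW (a l k • w l) - realLevel ℓV (v k) ≤
      realLevel ℓW (a i j • w i) - realLevel ℓV (v j) := fun k l hk hl =>
    hmax (k, l) (by simp [hk, hl])
  have hAj : A (v j) ≠ 0 := by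
    intro h
    apply hij
    simp [ha, h]
  have hiS : i ∉ f '' S := haf i j hj hij
  -- Maximality of the pivot within column `j` makes `a i j • w i` a dominant term of `A (v j)`,
  -- which may thus replace `w i`.
  have hw' := hw.update hW (i := i) hAj (by
    conv_lhs => rw [hsum]
    refine hW.sum_le fun l _ => ?_
    by_cases hl : a l j = 0
    · simp [hl, hW.map_zero]
    · change _ ≤ ℓW (a i j • w i)
      rw [← hW.coe_realLevel (smul_ne_zero hl (hw.ne_zero l)),
        ← hW.coe_realLevel (smul_ne_zero hij (hw.ne_zero i)), WithBot.coe_le_coe]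
      linarith [hmax' j l hj hl])
  set c : ι → NovikovField K Γ := fun k => if k = j then 0 else a i k / a i j with hc
  have haS : ∀ k ∈ S, a i k = 0 := by
    intro k hk
    have h1 := (hw.basis hW).repr_self_apply (f k) i
    rw [hw.basis_apply, if_neg (fun h => hiS ⟨k, hk, h⟩)] at h1
    rw [ha]
    dsimp only
    rw [hS k hk, h1]
  -- Maximality of the pivot within row `i` gives `ℓ (cₖ vⱼ) ≤ ℓ vₖ`, so clearing row `i` preserves
  -- orthogonality. Vectors already in normal form have `cₖ = 0`.
  have hv' := hv.sub_smul hV (j := j) (c := c) (by simp [hc]) (by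
    intro k
    by_cases hk : k ∈ S
    · have : c k = 0 := by simp [hc, haS k hk]
      simp [this, hV.map_zero]
    by_cases hkj : k = j
    · have : c k = 0 := by simp [hc, hkj]
      simp [this, hV.map_zero]
    by_cases hak : a i k = 0
    · have : c k = 0 := by simp [hc, hak]
      simp [this, hV.map_zero]
    have hck : c k = a i k / a i j := by simp [hc, hkj]
    have hck0 : c k ≠ 0 := by rw [hck]; exact div_ne_zero hak hij
    rw [← hV.coe_realLevel (smul_ne_zero hck0 (hv.ne_zero j)),
      ← hV.coe_realLevel (hv.ne_zero k), WithBot.coe_le_coe,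
      hV.realLevel_smul hck0 (hv.ne_zero j)]
    have h1 : NovikovField.val (a i k) = NovikovField.val (c k) + NovikovField.val (a i j) := by
      rw [← NovikovField.val_mul hck0 hij, hck, div_mul_cancel₀ _ hij]
    have h2 := hmax' k i hk hak
    rw [hW.realLevel_smul hak (hw.ne_zero i), hW.realLevel_smul hij (hw.ne_zero i)] at h2
    linarith)
  have hfS : ∀ s ∈ S, Function.update f j i s = f s := fun s hs =>
    Function.update_of_ne (fun h : s = j => hj (h ▸ hs)) _ _
  have himage : Function.update f j i '' (insert j S : Finset ι) = insert i (f '' S) := by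
    rw [Finset.coe_insert, Set.image_insert_eq, Function.update_self]
    congr 1
    exact Set.image_congr hfS
  refine ⟨j, hj, insert j S, Finset.subset_insert _ _, Finset.mem_insert_self _ _,
    ⟨Function.update f j i, fun k => v k - c k • v j, Function.update w i (A (v j)), hv', hw',
      ?_, ?_, ?_⟩⟩
  · rw [Finset.coe_insert, Set.injOn_insert (by simpa using hj)]
    refine ⟨fun x hx y hy hxy => ?_, ?_⟩
    · rw [hfS x hx, hfS y hy] at hxy
      exact hf hx hy hxy
    · rw [Function.update_self, Set.image_congr hfS]
      exact hiS
  · intro s hs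
    rcases Finset.mem_insert.mp hs with rfl | hs
    · simp [hc]
    · have hcs : c s = 0 := by simp [hc, haS s hs]
      rw [hfS s hs, Function.update_of_ne (fun h => hiS ⟨s, hs, h⟩)]
      simp [hcs, hS s hs]
  · intro k hk
    obtain ⟨hkj, hkS⟩ : k ≠ j ∧ k ∉ S := by simpa using hk
    have h1 : Function.update w i (A (v j)) '' (insert i (f '' S))ᶜ
        = w '' (insert i (f '' S))ᶜ := by
      refine Set.image_congr fun l hl => Function.update_of_ne (fun h => hl ?_) _ _
      exact Or.inl h
    rw [himage, h1, ← hw.coe_basis hW, Module.Basis.mem_span_image]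
    intro l hl
    have hl' : a l k - a i k / a i j * a l j ≠ 0 := by
      simpa [hc, hkj, ha] using hl
    rintro (rfl | hlS)
    · apply hl'
      field_simp
      simp
    · have e1 : a l k = 0 := by
        by_contra h
        exact haf l k hkS h hlS
      have e2 : a l j = 0 := by
        by_contra h
        exact haf l j hj h hlS
      simp [e1, e2] at hl'

theorem PartialDiagonalization.exists_complete {ι κ : Type*} [Fintype ι] [Fintype κ]
    (hV : IsFiltrationFunction (K := K) (Γ := Γ) ℓV)
    (hW : IsFiltrationFunction (K := K) (Γ := Γ) ℓW) {A : V →ₗ[NovikovField K Γ] W}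
    {S₀ : Finset ι} (P₀ : PartialDiagonalization (κ := κ) ℓV ℓW A S₀) :
    ∃ (S : Finset ι) (P : PartialDiagonalization (κ := κ) ℓV ℓW A S),
      ∀ k ∉ S, A (P.v k) = 0 := by
  classical
  induction hn : S₀ᶜ.card using Nat.strong_induction_on generalizing S₀ with
  | _ n ih =>
    by_cases hP : ∃ k ∉ S₀, A (P₀.v k) ≠ 0
    · obtain ⟨j, hj, S', hSS', hjS', ⟨P'⟩⟩ := P₀.exists_insert hV hW hP
      refine ih _ ?_ P' rfl
      rw [← hn]
      refine Finset.card_lt_card (Finset.ssubset_iff_subset_ne.mpr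
        ⟨Finset.compl_subset_compl.mpr hSS', fun h => ?_⟩)
      have : j ∈ S'ᶜ := by rw [h]; simpa using hj
      simp [hjS'] at this
    · push Not at hP
      exact ⟨S₀, P₀, hP⟩

/-- A linear map between orthogonalizable spaces is diagonal with respect to suitable orthogonal
bases. -/
theorem exists_diagonalization {ι κ : Type*} [Fintype ι] [Fintype κ]
    (hV : IsFiltrationFunction (K := K) (Γ := Γ) ℓV)
    (hW : IsFiltrationFunction (K := K) (Γ := Γ) ℓW) (A : V →ₗ[NovikovField K Γ] W)
    {v : ι → V} {w : κ → W} (hv : IsOrthogonalBasis K Γ ℓV v) (hw : IsOrthogonalBasis K Γ ℓW w) :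
    ∃ (r : ℕ) (g : Fin r → ι) (h : Fin r → κ) (v : ι → V) (w : κ → W),
      IsOrthogonalBasis K Γ ℓV v ∧ IsOrthogonalBasis K Γ ℓW w ∧
      Function.Injective g ∧ Function.Injective h ∧ (∀ i, A (v (g i)) = w (h i)) ∧
      (∀ k ∉ Set.range g, A (v k) = 0) ∧
      Antitone fun i => realLevel ℓV (v (g i)) - realLevel ℓW (w (h i)) := by
  rcases isEmpty_or_nonempty κ with hκ | ⟨⟨i₀⟩⟩
  · have hz : ∀ x : W, x = 0 := fun x => by
      rw [← hw.sum_repr hW x]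
      simp
    exact ⟨0, Fin.elim0, Fin.elim0, v, w, hv, hw, fun i => i.elim0, fun i => i.elim0,
      fun i => i.elim0, fun k _ => hz _, fun i => i.elim0⟩
  obtain ⟨S, P, hP⟩ := PartialDiagonalization.exists_complete hV hW (A := A) (S₀ := ∅)
    ⟨fun _ => i₀, v, w, hv, hw, by simp, by simp, fun k _ => by simpa using hw.span trivial⟩
  let e := S.equivFin
  -- The sign turns the increasing order produced by `Tuple.sort` into the decreasing order of a
  -- singular value decomposition.
  let d : Fin S.card → ℝ := fun i =>
    -(realLevel ℓV (P.v (e.symm i)) - realLevel ℓW (P.w (P.f (e.symm i))))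
  have hd := Tuple.monotone_sort d
  refine ⟨S.card, fun i => e.symm (Tuple.sort d i), fun i => P.f (e.symm (Tuple.sort d i)), P.v,
    P.w, P.v_basis, P.w_basis, ?_, ?_, fun i => P.map_of_mem _ (e.symm _).2, ?_, ?_⟩
  · exact Subtype.val_injective.comp (e.symm.injective.comp (Tuple.sort d).injective)
  · intro i j hij
    have := P.injOn (e.symm _).2 (e.symm _).2 hij
    exact (Tuple.sort d).injective (e.symm.injective (Subtype.ext this))
  · intro k hk
    refine hP k fun hkS => hk ⟨(Tuple.sort d).symm (e ⟨k, hkS⟩), by simp⟩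
  · intro i j hij
    have := hd hij
    simp only [d, Function.comp_apply] at this
    linarith

/-- An enumeration of a finite type that starts with a given injective family. -/
theorem exists_equiv_fin_extending {ι : Type*} [Fintype ι] {r : ℕ} {g : Fin r → ι}
    (hg : Function.Injective g) :
    ∃ (n : ℕ) (e : Fin n ≃ ι), ∀ (i : Fin n) (j : Fin r), i.1 = j.1 ↔ e i = g j := by
  classical
  let e : Fin (r + Fintype.card ↥(Set.range g)ᶜ) ≃ ι :=
    finSumFinEquiv.symm.trans (((Equiv.ofInjective g hg).sumCongr (Fintype.equivFin _).symm).trans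
      (Equiv.Set.sumCompl (Set.range g)))
  have he : ∀ j : Fin r, e (Fin.castAdd _ j) = g j := by
    intro j
    simp [e]
  refine ⟨_, e, fun i j => ⟨fun h => ?_, fun h => ?_⟩⟩
  · rw [← he j]
    exact congrArg e (Fin.ext h)
  · rw [← he j] at h
    simpa using congrArg Fin.val (e.injective h)

theorem IsOrthogonalBasis.comp_equiv {ι κ : Type*} [Fintype ι] [Fintype κ] {v : ι → V}
    (hv : IsOrthogonalBasis K Γ ℓV v) (e : κ ≃ ι) : IsOrthogonalBasis K Γ ℓV (v ∘ e) := by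
  refine ⟨fun a i => ?_, fun i => hv.ne_zero _, ?_⟩
  · have := hv.smul_le (a ∘ e.symm) (e i)
    rw [← e.sum_comp] at this
    simpa using this
  · rw [e.surjective.range_comp]
    exact hv.span

theorem nonempty_singularValueDecomposition (hV : IsOrthogonalizable K Γ V ℓV)
    (hW : IsOrthogonalizable K Γ W ℓW) (A : V →ₗ[NovikovField K Γ] W) :
    Nonempty (SingularValueDecomposition ℓV ℓW A) := by
  obtain ⟨hV, _, b, hb⟩ := hV
  obtain ⟨hW, _, c, hc⟩ := hW
  obtain ⟨r, g, h, v, w, hv, hw, hg, hh, hA, hA0, hanti⟩ :=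
    exists_diagonalization hV hW A (hV.isOrthogonalBasis hb) (hW.isOrthogonalBasis hc)
  obtain ⟨n, e, he⟩ := exists_equiv_fin_extending hg
  obtain ⟨m, e', he'⟩ := exists_equiv_fin_extending hh
  have hlt : ∀ i : Fin n, e i ∈ Set.range g ↔ i.1 < r := by
    intro i
    constructor
    · rintro ⟨j, hj⟩
      rw [(he i j).mpr hj.symm]
      exact j.2
    · intro hi
      exact ⟨⟨i.1, hi⟩, ((he i ⟨i.1, hi⟩).mp rfl).symm⟩
  have hlt' : ∀ i : Fin m, e' i ∈ Set.range h ↔ i.1 < r := by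
    intro i
    constructor
    · rintro ⟨j, hj⟩
      rw [(he' i j).mpr hj.symm]
      exact j.2
    · intro hi
      exact ⟨⟨i.1, hi⟩, ((he' i ⟨i.1, hi⟩).mp rfl).symm⟩
  have hrange : LinearMap.range A = Submodule.span (NovikovField K Γ) (Set.range (w ∘ h)) := by
    apply le_antisymm
    · rw [LinearMap.range_eq_map, ← top_le_iff.mp hv.span, Submodule.map_span_le]
      rintro _ ⟨k, rfl⟩
      by_cases hk : k ∈ Set.range g
      · obtain ⟨i, rfl⟩ := hk
        rw [hA]
        exact Submodule.subset_span ⟨i, rfl⟩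
      · rw [hA0 k hk]
        exact zero_mem _
    · rw [Submodule.span_le]
      rintro _ ⟨i, rfl⟩
      exact ⟨v (g i), hA i⟩
  have hr : Module.finrank (NovikovField K Γ) (LinearMap.range A) = r := by
    rw [hrange, finrank_span_eq_card
      ((hW.linearIndependent hw.smul_le hw.ne_zero).comp h hh)]
    simp
  have hy := hv.comp_equiv e
  have hx := hw.comp_equiv e'
  refine ⟨⟨n, m, hy.basis hV, hx.basis hW, ?_, ?_, ?_, ?_, ?_, ?_⟩⟩
  · rw [hV.isOrthogonalFamily_iff, hy.coe_basis]
    exact hy.smul_le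
  · rw [hW.isOrthogonalFamily_iff, hx.coe_basis]
    exact hx.smul_le
  · rw [hr]
    apply le_antisymm
    · rw [Submodule.span_le]
      rintro _ ⟨i, hi, rfl⟩
      rw [hy.basis_apply]
      exact hA0 _ fun h => absurd ((hlt i).mp h) (not_lt.mpr hi)
    · intro z hz
      rw [Module.Basis.mem_span_image]
      intro i hi
      by_contra hir
      have hir : i.1 < r := not_le.mp hir
      have hz' : A z = 0 := hz
      -- Applying `A` to the expansion of `z` leaves a relation among the independent vectors `w (h
      -- i)`, so the coordinates of `z` along the `v (g i)` vanish.
      rw [← hv.sum_repr hV z, map_sum, ← Finset.sum_subset (Finset.subset_univ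
        (Finset.univ.map ⟨g, hg⟩)) (fun k _ hk => by
          rw [map_smul, hA0 k (by simpa using hk), smul_zero]), Finset.sum_map] at hz'
      simp only [Function.Embedding.coeFn_mk, map_smul, hA] at hz'
      have h0 := Fintype.linearIndependent_iff.mp
        ((hW.linearIndependent hw.smul_le hw.ne_zero).comp h hh) _ hz' ⟨i.1, hir⟩
      have h1 : (hy.basis hV).repr z i = (hv.basis hV).repr z (e i) := by
        have : hy.basis hV = (hv.basis hV).reindex e.symm := by
          apply Module.Basis.eq_of_apply_eq
          intro i
          simp [hy.basis_apply, hv.basis_apply]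
        rw [this]
        simp
      rw [Finset.mem_coe, Finsupp.mem_support_iff, h1, (he i ⟨i.1, hir⟩).mp rfl] at hi
      exact hi h0
  · rw [hr, hrange, hx.coe_basis, Set.image_comp]
    congr 1
    rw [Set.range_comp]
    congr 1
    ext k
    constructor
    · rintro ⟨i, hi, rfl⟩
      exact (hlt' i).mpr hi
    · intro hk
      refine ⟨e'.symm k, (hlt' _).mp (by simpa using hk), by simp⟩
  · intro i j hij hi
    rw [hr] at hi
    rw [hy.basis_apply, hx.basis_apply]
    have h1 := (he i ⟨i.1, hi⟩).mp rfl
    have h2 := (he' j ⟨i.1, hi⟩).mp hij.symm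
    simp [h1, h2, hA]
  · intro i i' j j' hij hij' hii' hi'
    rw [hr] at hi'
    simp only [hy.basis_apply, hx.basis_apply, Function.comp_apply]
    have hi : i.1 < r := hii'.trans_lt hi'
    rw [(he i ⟨i.1, hi⟩).mp rfl, (he' j ⟨i.1, hi⟩).mp hij.symm, (he i' ⟨i'.1, hi'⟩).mp rfl,
      (he' j' ⟨i'.1, hi'⟩).mp hij'.symm]
    exact hanti (show (⟨i.1, hi⟩ : Fin r) ≤ ⟨i'.1, hi'⟩ from hii')

/-- The kernel of a linear map between orthogonalizable spaces is orthogonalizable. -/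
theorem IsOrthogonalizable.ker (hV : IsOrthogonalizable K Γ V ℓV)
    (hW : IsOrthogonalizable K Γ W ℓW) (A : V →ₗ[NovikovField K Γ] W) :
    IsOrthogonalizable K Γ (LinearMap.ker A) fun z => ℓV z.1 := by
  classical
  obtain ⟨S⟩ := nonempty_singularValueDecomposition hV hW A
  have hVf := hV.isFiltrationFunction
  have hf : IsFiltrationFunction (K := K) (Γ := Γ) fun z : LinearMap.ker A => ℓV z.1 :=
    ⟨fun x => by simpa using hVf.eq_bot_iff x.1, fun a x => hVf.smul a x.1,
      fun x y => hVf.add_le x.1 y.1⟩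
  set T := {i : Fin S.n // Module.finrank (NovikovField K Γ) (LinearMap.range A) ≤ i.1}
  have hmem : ∀ i : T, S.y i.1 ∈ LinearMap.ker A := fun i => by
    rw [← S.span_ker]
    exact Submodule.subset_span ⟨i.1, i.2, rfl⟩
  have horth := hVf.isOrthogonalFamily_iff.mp S.y_orthogonal
  have hb : IsOrthogonalBasis K Γ (fun z : LinearMap.ker A => ℓV z.1)
      fun i : T => (⟨S.y i.1, hmem i⟩ : LinearMap.ker A) := by
    refine ⟨fun a i => ?_, fun i h => S.y.ne_zero i.1 (congrArg Subtype.val h), ?_⟩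
    · have := horth (fun k => if h : _ then a ⟨k, h⟩ else 0) i.1
      rw [dif_pos i.2, ← Finset.sum_subset (Finset.subset_univ
        (Finset.univ.map (Function.Embedding.subtype _))) (fun k _ hk => by
          rw [dif_neg (fun h => hk (Finset.mem_map.mpr ⟨⟨k, h⟩, Finset.mem_univ _, rfl⟩)), zero_smul]), Finset.sum_map] at this
      have e : ∑ x : T, (if h : Module.finrank (NovikovField K Γ) (LinearMap.range A) ≤ x.1.1
          then a ⟨x.1, h⟩ else 0) • S.y x.1 = ∑ x : T, a x • S.y x.1 :=
        Finset.sum_congr rfl fun x _ => by rw [dif_pos x.2]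
      refine (this.trans_eq (congrArg ℓV e)).trans_eq ?_
      simp
    · rintro z -
      have hz := S.span_ker.ge z.2
      rw [Set.image_eq_range] at hz
      have : Submodule.map (LinearMap.ker A).subtype (Submodule.span (NovikovField K Γ)
          (Set.range fun i : T => (⟨S.y i.1, hmem i⟩ : LinearMap.ker A))) =
          Submodule.span (NovikovField K Γ) (Set.range fun i : T => S.y i.1) := by
        rw [Submodule.map_span, ← Set.range_comp]
        rfl
      have hz' : (LinearMap.ker A).subtype z ∈ Submodule.span (NovikovField K Γ)
        (Set.range fun i : T => S.y i.1) := hz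
      rw [← this] at hz'
      obtain ⟨z', hz', h⟩ := hz'
      rwa [← Subtype.ext (a1 := z') (a2 := z) h]
  have hb' := hb.comp_equiv (Fintype.equivFin T).symm
  refine ⟨hf, _, hb'.basis hf, ?_⟩
  rw [hf.isOrthogonalFamily_iff, hb'.coe_basis]
  exact hb'.smul_le

end Existence

/-! ### Bars of a singular value decomposition -/

namespace SingularValueDecomposition

open NovikovField

variable {K : Type*} [Field K] {Γ : AddSubgroup ℝ}
variable {V : Type*} [AddCommGroup V] [Module (NovikovField K Γ) V] {ℓV : V → WithBot ℝ}
variable {W : Type*} [AddCommGroup W] [Module (NovikovField K Γ) W] {ℓW : W → WithBot ℝ}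
variable {A : V →ₗ[NovikovField K Γ] W}
variable {V' : Type*} [AddCommGroup V'] [Module (NovikovField K Γ) V'] {ℓV' : V' → WithBot ℝ}
variable {W' : Type*} [AddCommGroup W'] [Module (NovikovField K Γ) W'] {ℓW' : W' → WithBot ℝ}
variable {A' : V' →ₗ[NovikovField K Γ] W'}
variable (S : SingularValueDecomposition ℓV ℓW A) (S' : SingularValueDecomposition ℓV' ℓW' A')

/-- The bar with index `j` is finite. -/
def IsFin (j : Fin S.m) : Prop :=
  j.1 < Module.finrank (NovikovField K Γ) (LinearMap.range A)

open Classical in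
/-- The basis vector `yⱼ` if the `j`-th bar is finite, and `0` otherwise. -/
def lift (j : Fin S.m) : V :=
  if h : S.IsFin j then S.y ⟨j.1, h.trans_le S.rank_le⟩ else 0

/-- The `j`-th element of the verbose barcode. -/
def bar (j : Fin S.m) : (ℝ ⧸ Γ) × ℝ≥0∞ :=
  (QuotientAddGroup.mk (realLevel ℓW (S.x j)),
    if h : j.1 < Module.finrank (NovikovField K Γ) (LinearMap.range A) then
      ENNReal.ofReal
        (realLevel ℓV (S.y ⟨j.1, h.trans_le S.rank_le⟩) - realLevel ℓW (S.x j))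
    else ⊤)

theorem verboseBarcode_eq : S.verboseBarcode = (Finset.univ : Finset (Fin S.m)).val.map S.bar := rfl

/-- The level `ℓ xⱼ` at which the `j`-th bar starts. -/
def start (j : Fin S.m) : ℝ := realLevel ℓW (S.x j)

open Classical in
/-- The level `ℓ yⱼ` at which the `j`-th bar ends if it is finite; for an infinite bar, the level
at which it starts. -/
def finish (j : Fin S.m) : ℝ := if S.IsFin j then realLevel ℓV (S.lift j) else S.start j

variable {S S'}

theorem IsFin.lift_eq {j : Fin S.m} (h : S.IsFin j) :
    S.lift j = S.y ⟨j.1, h.trans_le S.rank_le⟩ := dif_pos h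

theorem lift_eq_zero {j : Fin S.m} (h : ¬ S.IsFin j) : S.lift j = 0 := dif_neg h

theorem IsFin.lift_ne_zero {j : Fin S.m} (h : S.IsFin j) : S.lift j ≠ 0 := by
  rw [h.lift_eq]
  exact S.y.ne_zero _

theorem IsFin.finish_eq {j : Fin S.m} (h : S.IsFin j) : S.finish j = realLevel ℓV (S.lift j) :=
  if_pos h

theorem finish_eq_start {j : Fin S.m} (h : ¬ S.IsFin j) : S.finish j = S.start j := if_neg h

theorem IsFin.map_lift {j : Fin S.m} (h : S.IsFin j) : A (S.lift j) = S.x j := by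
  rw [h.lift_eq]
  exact S.map_y _ _ rfl h

theorem bar_fst (j : Fin S.m) : (S.bar j).1 = QuotientAddGroup.mk (S.start j) := rfl

theorem IsFin.bar_snd {j : Fin S.m} (h : S.IsFin j) :
    (S.bar j).2 = ENNReal.ofReal (S.finish j - S.start j) := by
  have : (S.bar j).2 = ENNReal.ofReal
      (realLevel ℓV (S.y ⟨j.1, h.trans_le S.rank_le⟩) - realLevel ℓW (S.x j)) := dif_pos h
  rw [this, h.finish_eq, h.lift_eq, start]

theorem bar_snd_eq_top {j : Fin S.m} (h : ¬ S.IsFin j) : (S.bar j).2 = ⊤ := dif_neg h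

theorem bar_snd_ne_top {j : Fin S.m} (h : S.IsFin j) : (S.bar j).2 ≠ ⊤ := by
  rw [h.bar_snd]
  exact ENNReal.ofReal_ne_top

theorem start_le_finish (hV : IsFiltrationFunction (K := K) (Γ := Γ) ℓV)
    (hW : IsFiltrationFunction (K := K) (Γ := Γ) ℓW) (hA : ∀ v, ℓW (A v) ≤ ℓV v)
    (j : Fin S.m) : S.start j ≤ S.finish j := by
  by_cases h : S.IsFin j
  · rw [h.finish_eq, start, ← WithBot.coe_le_coe, hW.coe_realLevel (S.x.ne_zero j),
      hV.coe_realLevel h.lift_ne_zero, ← h.map_lift]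
    exact hA _
  · rw [finish_eq_start h]

theorem rank_le_m (S : SingularValueDecomposition ℓV ℓW A) :
    Module.finrank (NovikovField K Γ) (LinearMap.range A) ≤ S.m := by
  have : Module.Finite (NovikovField K Γ) W := Module.Finite.of_basis S.x
  calc _ ≤ Module.finrank (NovikovField K Γ) W := Submodule.finrank_le _
    _ = S.m := by simp [Module.finrank_eq_card_basis S.x]

theorem map_y_eq_zero {i : Fin S.n}
    (h : ¬ i.1 < Module.finrank (NovikovField K Γ) (LinearMap.range A)) : A (S.y i) = 0 := by
  have : S.y i ∈ LinearMap.ker A := by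
    rw [← S.span_ker]
    exact Submodule.subset_span ⟨i, not_lt.mp h, rfl⟩
  exact this

theorem IsFin.repr_map {j : Fin S.m} (h : S.IsFin j) (c : V) :
    S.x.repr (A c) j = S.y.repr c ⟨j.1, h.trans_le S.rank_le⟩ := by
  conv_lhs => rw [← S.y.sum_repr c]
  simp only [map_sum, map_smul, Finsupp.finsetSum_apply, Finsupp.smul_apply]
  rw [Finset.sum_eq_single ⟨j.1, h.trans_le S.rank_le⟩]
  · rw [S.map_y ⟨j.1, h.trans_le S.rank_le⟩ j rfl h]
    simp
  · intro i _ hi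
    by_cases hir : i.1 < Module.finrank (NovikovField K Γ) (LinearMap.range A)
    · rw [S.map_y i ⟨i.1, hir.trans_le S.rank_le_m⟩ rfl hir, S.x.repr_self,
        Finsupp.single_eq_of_ne, smul_zero]
      intro hj
      exact hi (Fin.ext (congrArg Fin.val hj).symm)
    · simp [map_y_eq_zero hir]
  · simp

theorem repr_map_eq_zero {j : Fin S.m} (h : ¬ S.IsFin j) (c : V) : S.x.repr (A c) j = 0 := by
  conv_lhs => rw [← S.y.sum_repr c]
  simp only [map_sum, map_smul, Finsupp.finsetSum_apply, Finsupp.smul_apply]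
  refine Finset.sum_eq_zero fun i _ => ?_
  by_cases hir : i.1 < Module.finrank (NovikovField K Γ) (LinearMap.range A)
  · rw [S.map_y i ⟨i.1, hir.trans_le S.rank_le_m⟩ rfl hir, S.x.repr_self,
      Finsupp.single_eq_of_ne, smul_zero]
    rintro rfl
    exact h hir
  · simp [map_y_eq_zero hir]

/-- The coordinate of `A c` along `xⱼ` is that of `c` along `yⱼ`, so orthogonality of the `yⱼ`
applies. It shows that no preimage of a boundary lies lower than the combination of the `yⱼ` read
off from its coordinates. -/
theorem repr_smul_lift_le (hV : IsFiltrationFunction (K := K) (Γ := Γ) ℓV) (c : V)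
    (j : Fin S.m) : ℓV (S.x.repr (A c) j • S.lift j) ≤ ℓV c := by
  by_cases h : S.IsFin j
  · rw [h.repr_map, h.lift_eq]
    have := hV.isOrthogonalFamily_iff.mp S.y_orthogonal (S.y.repr c) ⟨j.1, h.trans_le S.rank_le⟩
    rwa [S.y.sum_repr] at this
  · simp [repr_map_eq_zero h, hV.map_zero]

theorem repr_smul_x_le (hW : IsFiltrationFunction (K := K) (Γ := Γ) ℓW) (z : W)
    (j : Fin S.m) : ℓW (S.x.repr z j • S.x j) ≤ ℓW z := by
  have := hW.isOrthogonalFamily_iff.mp S.x_orthogonal (S.x.repr z) j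
  rwa [S.x.sum_repr] at this

theorem start_sub_val_le (hW : IsFiltrationFunction (K := K) (Γ := Γ) ℓW) {z : W} {c : ℝ}
    (hz : ℓW z ≤ c) {j : Fin S.m} (h0 : S.x.repr z j ≠ 0) :
    S.start j - val (S.x.repr z j) ≤ c :=
  (hW.smul_le_coe_iff (S.x.ne_zero j)).mp ((repr_smul_x_le hW z j).trans hz) h0

theorem finish_sub_val_le (hV : IsFiltrationFunction (K := K) (Γ := Γ) ℓV) {v : V} {c : ℝ}
    (hv : ℓV v ≤ c) {j : Fin S.m} (h0 : S.x.repr (A v) j ≠ 0) :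
    S.IsFin j ∧ S.finish j - val (S.x.repr (A v) j) ≤ c := by
  have hj : S.IsFin j := by
    by_contra hj
    exact h0 (repr_map_eq_zero hj v)
  refine ⟨hj, ?_⟩
  rw [hj.finish_eq]
  exact (hV.smul_le_coe_iff hj.lift_ne_zero).mp ((repr_smul_lift_le hV v j).trans hv) h0

variable (S S') in
/-- Two bars are related if they are both finite or both infinite, and a translate of the second
one by an element of `Γ` has endpoints within `c` of those of the first one. -/
def Related (c : ℝ) (i : Fin S.m) (j : Fin S'.m) : Prop :=
  (S.IsFin i ↔ S'.IsFin j) ∧ ∃ g ∈ Γ, |S'.start j - g - S.start i| ≤ c ∧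
    |S'.finish j - g - S.finish i| ≤ c

theorem Related.symm {c : ℝ} {i : Fin S.m} {j : Fin S'.m} (h : Related S S' c i j) :
    Related S' S c j i := by
  obtain ⟨hij, g, hg, h1, h2⟩ := h
  refine ⟨hij.symm, -g, neg_mem hg, ?_, ?_⟩
  · rw [← abs_neg]
    convert h1 using 2
    ring
  · rw [← abs_neg]
    convert h2 using 2
    ring

theorem Related.matched {δ : ℝ≥0} {i : Fin S.m} {j : Fin S'.m} (h : Related S S' δ i j)
    (hi : S.start i ≤ S.finish i) (hj : S'.start j ≤ S'.finish j) :
    Barcode.Matched δ (S.bar i) (S'.bar j) := by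
  obtain ⟨hij, g, hg, h1, h2⟩ := h
  intro a ha ε hε
  rw [bar_fst, QuotientAddGroup.eq] at ha
  -- The representative `a` differs from `S.start i` by an element of `Γ`; the shifted second bar is
  -- translated by the same amount.
  refine ⟨S'.start j - g + (a - S.start i), ?_, ?_, ?_⟩
  · rw [bar_fst, QuotientAddGroup.eq]
    have := add_mem hg ha
    convert this using 1
    ring
  · refine le_trans (le_of_eq ?_) (h1.trans (by linarith))
    congr 1
    ring
  · by_cases hf : S.IsFin i
    · right
      refine ⟨bar_snd_ne_top hf, bar_snd_ne_top (hij.mp hf), ?_⟩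
      rw [hf.bar_snd, (hij.mp hf).bar_snd, ENNReal.toReal_ofReal (by linarith),
        ENNReal.toReal_ofReal (by linarith)]
      refine le_trans (le_of_eq ?_) (h2.trans (by linarith))
      congr 1
      ring
    · exact Or.inl ⟨bar_snd_eq_top hf, bar_snd_eq_top (mt hij.mpr hf)⟩

/-- The strict inequality `δ < c` absorbs the `ε` in the definition of a matching: take `ε = c - δ`.
-/
theorem related_of_matched {δ : ℝ≥0} {c : ℝ} (hc : δ < c) {i : Fin S.m} {j : Fin S'.m}
    (h : Barcode.Matched δ (S.bar i) (S'.bar j))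
    (hi : S.start i ≤ S.finish i) (hj : S'.start j ≤ S'.finish j) : Related S S' c i j := by
  obtain ⟨a', ha', h1, h2⟩ := h (S.start i) rfl (c - δ) (by linarith)
  rw [bar_fst, QuotientAddGroup.eq] at ha'
  have e : (δ : ℝ) + (c - δ) = c := by ring
  rw [e] at h1 h2
  have hg : S'.start j - a' ∈ Γ := by
    convert ha' using 1
    ring
  have h1' : |S'.start j - (S'.start j - a') - S.start i| ≤ c := by
    convert h1 using 2
    ring
  rcases h2 with ⟨hi2, hj2⟩ | ⟨hi2, hj2, h2⟩
  · have hfi : ¬ S.IsFin i := fun h => bar_snd_ne_top h hi2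
    have hfj : ¬ S'.IsFin j := fun h => bar_snd_ne_top h hj2
    refine ⟨iff_of_false hfi hfj, _, hg, h1', ?_⟩
    rwa [finish_eq_start hfi, finish_eq_start hfj]
  · have hfi : S.IsFin i := by
      by_contra h
      exact hi2 (bar_snd_eq_top h)
    have hfj : S'.IsFin j := by
      by_contra h
      exact hj2 (bar_snd_eq_top h)
    refine ⟨iff_of_true hfi hfj, _, hg, h1', ?_⟩
    rw [hfi.bar_snd, hfj.bar_snd, ENNReal.toReal_ofReal (by linarith),
        ENNReal.toReal_ofReal (by linarith)] at h2
    convert h2 using 2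
    ring

/-! ### Stability -/

/-- The midpoint of a bar. -/
def mid (S : SingularValueDecomposition ℓV ℓW A) (i : Fin S.m) : ℝ := (S.start i + S.finish i) / 2

section Stability

variable {δ : ℝ} {TV : V →ₗ[NovikovField K Γ] V'} {TW : W →ₗ[NovikovField K Γ] W'}

/-- For a finite bar, `TW xᵢ = A' (TV yᵢ)` is a boundary with a preimage at level at most `ℓ yᵢ +
δ`. So it has no coordinates on infinite bars, and the finishes of the bars that occur in it are
controlled. -/
theorem repr_ne_zero_of_isFin (hV : IsFiltrationFunction (K := K) (Γ := Γ) ℓV)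
    (hV' : IsFiltrationFunction (K := K) (Γ := Γ) ℓV')
    (hT : ∀ v, A' (TV v) = TW (A v)) (hTV : ∀ v, ℓV' (TV v) ≤ ℓV v + (δ : WithBot ℝ))
    {i : Fin S.m} {j : Fin S'.m} (hi : S.IsFin i) (h0 : S'.x.repr (TW (S.x i)) j ≠ 0) :
    S'.IsFin j ∧ S'.finish j - val (S'.x.repr (TW (S.x i)) j) ≤ S.finish i + δ := by
  have hv : ℓV' (TV (S.lift i)) ≤ ((S.finish i + δ : ℝ) : WithBot ℝ) := by
    refine (hTV _).trans_eq ?_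
    rw [WithBot.coe_add, hi.finish_eq, hV.coe_realLevel hi.lift_ne_zero]
  rw [← hi.map_lift, ← hT] at h0 ⊢
  exact finish_sub_val_le hV' hv h0

theorem start_sub_val_repr_le (hW : IsFiltrationFunction (K := K) (Γ := Γ) ℓW)
    (hW' : IsFiltrationFunction (K := K) (Γ := Γ) ℓW')
    (hTW : ∀ w, ℓW' (TW w) ≤ ℓW w + (δ : WithBot ℝ))
    {i : Fin S.m} {j : Fin S'.m} (h0 : S'.x.repr (TW (S.x i)) j ≠ 0) :
    S'.start j - val (S'.x.repr (TW (S.x i)) j) ≤ S.start i + δ := by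
  refine start_sub_val_le hW' ((hTW _).trans_eq ?_) h0
  rw [WithBot.coe_add, start, hW.coe_realLevel (S.x.ne_zero i)]

/-- Let `g` be the valuation of a nonzero entry. The start and finish differences, shifted by `g`,
are both at most `δ`. If `g` did not exceed the difference of midpoints, their sum would be
nonnegative, hence both would be at least `-δ` and the bars would be related via `g ∈ Γ`. -/
theorem valGT_of_not_related (hV : IsFiltrationFunction (K := K) (Γ := Γ) ℓV)
    (hV' : IsFiltrationFunction (K := K) (Γ := Γ) ℓV')
    (hW : IsFiltrationFunction (K := K) (Γ := Γ) ℓW)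
    (hW' : IsFiltrationFunction (K := K) (Γ := Γ) ℓW')
    (hT : ∀ v, A' (TV v) = TW (A v)) (hTV : ∀ v, ℓV' (TV v) ≤ ℓV v + (δ : WithBot ℝ))
    (hTW : ∀ w, ℓW' (TW w) ≤ ℓW w + (δ : WithBot ℝ)) {i : Fin S.m} {j : Fin S'.m}
    (hij : S.IsFin i ↔ S'.IsFin j) (hR : ¬ Related S S' δ i j) :
    ValGT (S'.mid j - S.mid i) (S'.x.repr (TW (S.x i)) j) := by
  intro h0
  have h1 := start_sub_val_repr_le hW hW' hTW h0
  have h2 : S'.finish j - val (S'.x.repr (TW (S.x i)) j) ≤ S.finish i + δ := by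
    by_cases hi : S.IsFin i
    · exact (repr_ne_zero_of_isFin hV hV' hT hTV hi h0).2
    · rwa [finish_eq_start hi, finish_eq_start (mt hij.mpr hi)]
  simp only [mid]
  by_contra hlt
  apply hR
  refine ⟨hij, _, val_mem (S'.x.repr (TW (S.x i)) j), ?_, ?_⟩ <;> rw [abs_le] <;>
    constructor <;> linarith

variable {UV : V' →ₗ[NovikovField K Γ] V} {UW : W' →ₗ[NovikovField K Γ] W}
  {H : W →ₗ[NovikovField K Γ] V}

open Classical in
/-- The bars of length greater than `2δ` can be matched. -/
theorem exists_injective_related (hV : IsFiltrationFunction (K := K) (Γ := Γ) ℓV)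
    (hV' : IsFiltrationFunction (K := K) (Γ := Γ) ℓV')
    (hW : IsFiltrationFunction (K := K) (Γ := Γ) ℓW)
    (hW' : IsFiltrationFunction (K := K) (Γ := Γ) ℓW')
    (hT : ∀ v, A' (TV v) = TW (A v)) (hTV : ∀ v, ℓV' (TV v) ≤ ℓV v + (δ : WithBot ℝ))
    (hTW : ∀ w, ℓW' (TW w) ≤ ℓW w + (δ : WithBot ℝ))
    (hU : ∀ v, A (UV v) = UW (A' v)) (hUV : ∀ v, ℓV (UV v) ≤ ℓV' v + (δ : WithBot ℝ))
    (hUW : ∀ w, ℓW (UW w) ≤ ℓW' w + (δ : WithBot ℝ))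
    (hH : ∀ w, UW (TW w) = A (H w) + w)
    (hHle : ∀ w, ℓV (H w) ≤ ℓW w + ((2 * δ : ℝ) : WithBot ℝ)) :
    ∃ f : {i : Fin S.m | S.IsFin i → 2 * δ < S.finish i - S.start i} → Fin S'.m,
      Function.Injective f ∧ ∀ i hi, Related S S' δ i (f ⟨i, hi⟩) := by
  suffices h : ∃ f : {i : Fin S.m | S.IsFin i → 2 * δ < S.finish i - S.start i} → Fin S'.m,
      Function.Injective f ∧ ∀ x, Related S S' δ x.1 (f x) by
    obtain ⟨f, hf, hR⟩ := h
    exact ⟨f, hf, fun i hi => hR ⟨i, hi⟩⟩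
  -- Entries between finite and infinite bars are set to `0`. Finite starts are boundaries and go to
  -- boundaries, so the matrices are block triangular and their diagonal blocks still multiply
  -- correctly.
  refine exists_injective_of_valGT (α := S.mid) (β := S'.mid)
    (φ := fun j i => if S.IsFin i ↔ S'.IsFin j then S'.x.repr (TW (S.x i)) j else 0)
    (ψ := fun i j => if S'.IsFin j ↔ S.IsFin i then S.x.repr (UW (S'.x j)) i else 0)
    (R := Related S S' δ) ?_ ?_ ?_
  · intro i j hR
    split_ifs with hij
    · exact valGT_of_not_related hV hV' hW hW' hT hTV hTW hij hR
    · exact fun h => absurd rfl h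
  · intro i j hR
    split_ifs with hij
    · exact valGT_of_not_related hV' hV hW' hW hU hUV hUW hij fun h => hR h.symm
    · exact fun h => absurd rfl h
  · intro i hi i' hi'
    by_cases hii : S.IsFin i ↔ S.IsFin i'
    -- The error `ΨΦ - 1` on cycles is `A ∘ H`, supported on finite bars. A nonzero entry has
    -- valuation at least `finish i' - start i - 2δ`; this exceeds `mid i' - mid i` because each of
    -- the two half-lengths is greater than `δ`.
    · refine ⟨S.x.repr (A (H (S.x i))) i', ?_, ?_⟩
      · intro h0
        have hle : ℓV (H (S.x i)) ≤ ((S.start i + 2 * δ : ℝ) : WithBot ℝ) := by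
          refine (hHle _).trans_eq ?_
          rw [WithBot.coe_add, start, hW.coe_realLevel (S.x.ne_zero i)]
        obtain ⟨h1, h2⟩ := finish_sub_val_le hV hle h0
        have h3 := hi' h1
        have h4 := hi (hii.mpr h1)
        simp only [mid]
        linarith
      · have h1 : S.x.repr (UW (TW (S.x i))) i' =
            ∑ j, S.x.repr (UW (S'.x j)) i' * S'.x.repr (TW (S.x i)) j := by
          conv_lhs => rw [← S'.x.sum_repr (TW (S.x i))]
          simp only [map_sum, map_smul, Finsupp.finsetSum_apply, Finsupp.smul_apply, smul_eq_mul]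
          exact Finset.sum_congr rfl fun j _ => mul_comm _ _
        rw [hH, map_add, Finsupp.add_apply, S.x.repr_self] at h1
        have h2 : (Finsupp.single i (1 : NovikovField K Γ)) i'
            = (Pi.single i' 1 : Fin S.m → NovikovField K Γ) i := by
          rw [Finsupp.single_apply, Pi.single_apply]
        rw [← h2, h1]
        refine Finset.sum_congr rfl fun j _ => ?_
        by_cases hij : S.IsFin i ↔ S'.IsFin j
        · rw [if_pos hij, if_pos (hij.symm.trans hii)]
        -- The discarded term was already `0`: one factor sends a finite start to an infinite one.
        · rw [if_neg hij, mul_zero, eq_comm]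
          by_cases hfi : S.IsFin i
          · have : S'.x.repr (TW (S.x i)) j = 0 := by
              by_contra h0
              exact hij (iff_of_true hfi (repr_ne_zero_of_isFin hV hV' hT hTV hfi h0).1)
            rw [this, mul_zero]
          · have hfj : S'.IsFin j := by
              by_contra h
              exact hij (iff_of_false hfi h)
            have : S.x.repr (UW (S'.x j)) i' = 0 := by
              by_contra h0
              exact hfi (hii.mpr (repr_ne_zero_of_isFin hV' hV hU hUV hfj h0).1)
            rw [this, zero_mul]
    · refine ⟨0, fun h => absurd rfl h, ?_⟩
      have hne : i ≠ i' := by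
        rintro rfl
        exact hii Iff.rfl
      rw [Pi.single_eq_of_ne hne, add_zero]
      refine Finset.sum_eq_zero fun j _ => ?_
      by_cases hij : S.IsFin i ↔ S'.IsFin j
      · rw [if_neg (fun h => hii (hij.trans h)), zero_mul]
      · rw [if_neg hij, mul_zero]

open Classical in
theorem hasMatching {δ : ℝ≥0} {H' : W' →ₗ[NovikovField K Γ] V'}
    (hV : IsFiltrationFunction (K := K) (Γ := Γ) ℓV)
    (hV' : IsFiltrationFunction (K := K) (Γ := Γ) ℓV')
    (hW : IsFiltrationFunction (K := K) (Γ := Γ) ℓW)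
    (hW' : IsFiltrationFunction (K := K) (Γ := Γ) ℓW')
    (hA : ∀ v, ℓW (A v) ≤ ℓV v) (hA' : ∀ v, ℓW' (A' v) ≤ ℓV' v)
    (hT : ∀ v, A' (TV v) = TW (A v)) (hTV : ∀ v, ℓV' (TV v) ≤ ℓV v + ((δ : ℝ) : WithBot ℝ))
    (hTW : ∀ w, ℓW' (TW w) ≤ ℓW w + ((δ : ℝ) : WithBot ℝ))
    (hU : ∀ v, A (UV v) = UW (A' v)) (hUV : ∀ v, ℓV (UV v) ≤ ℓV' v + ((δ : ℝ) : WithBot ℝ))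
    (hUW : ∀ w, ℓW (UW w) ≤ ℓW' w + ((δ : ℝ) : WithBot ℝ))
    (hH : ∀ w, UW (TW w) = A (H w) + w)
    (hHle : ∀ w, ℓV (H w) ≤ ℓW w + ((2 * δ : ℝ) : WithBot ℝ))
    (hH' : ∀ w, TW (UW w) = A' (H' w) + w)
    (hHle' : ∀ w, ℓV' (H' w) ≤ ℓW' w + ((2 * δ : ℝ) : WithBot ℝ)) :
    Barcode.HasMatching δ (S.verboseBarcode.filter fun p => 0 < p.2)
      (S'.verboseBarcode.filter fun p => 0 < p.2) := by
  obtain ⟨f, hf, hfR⟩ := exists_injective_related (S := S) (S' := S') hV hV' hW hW' hT hTV hTW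
    hU hUV hUW hH hHle
  obtain ⟨g, hg, hgR⟩ := exists_injective_related (S := S') (S' := S) hV' hV hW' hW hU hUV hUW
    hT hTV hTW hH' hHle'
  have hst := start_le_finish (S := S) hV hW hA
  have hst' := start_le_finish (S := S') hV' hW' hA'
  have hpos : ∀ {i : Fin S.m}, (S.IsFin i → 0 < S.finish i - S.start i) → 0 < (S.bar i).2 := by
    intro i hi
    by_cases h : S.IsFin i
    · rw [h.bar_snd]
      exact ENNReal.ofReal_pos.mpr (hi h)
    · rw [bar_snd_eq_top h]
      exact ENNReal.zero_lt_top
  have hpos' : ∀ {i : Fin S'.m}, (S'.IsFin i → 0 < S'.finish i - S'.start i) → 0 < (S'.bar i).2 := by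
    intro i hi
    by_cases h : S'.IsFin i
    · rw [h.bar_snd]
      exact ENNReal.ofReal_pos.mpr (hi h)
    · rw [bar_snd_eq_top h]
      exact ENNReal.zero_lt_top
  have h2δ : (0 : ℝ) ≤ 2 * δ := by positivity
  -- Positivity of both lengths is built into the relation, so that matched bars survive in the
  -- concise barcodes. The partner of a finite bar longer than `2δ` has positive length, since each
  -- endpoint moves by at most `δ`.
  obtain ⟨M, hM, hMR, hMi, hMj⟩ := exists_biUnique_of_injective
    (R := fun i j => Related S S' δ i j ∧ 0 < (S.bar i).2 ∧ 0 < (S'.bar j).2) hf hg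
    (by
      rintro ⟨i, hi⟩
      have hR := hfR i hi
      refine ⟨hR, hpos fun h => h2δ.trans_lt (hi h), hpos' fun h => ?_⟩
      obtain ⟨hij, g, -, h1, h2⟩ := hR
      have := hi (hij.mpr h)
      rw [abs_le] at h1 h2
      linarith)
    (by
      rintro ⟨i, hi⟩
      have hR := hgR i hi
      refine ⟨hR.symm, hpos fun h => ?_, hpos' fun h => h2δ.trans_lt (hi h)⟩
      obtain ⟨hij, g, -, h1, h2⟩ := hR
      have := hi (hij.mpr h)
      rw [abs_le] at h1 h2
      linarith)
  have h2 : (2 * (δ : ℝ≥0∞)) = ENNReal.ofReal (2 * δ) := by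
    rw [ENNReal.ofReal_mul (by norm_num)]
    simp
  rw [verboseBarcode_eq, verboseBarcode_eq]
  refine Barcode.hasMatching_of_biUnique hM
    (fun i j h => (hMR i j h).1.matched (hst i) (hst' j)) (fun i j h => (hMR i j h).2) ?_ ?_
  · intro i hi
    have : ¬ (S.IsFin i → 2 * δ < S.finish i - S.start i) := fun h => hi (hMi i h)
    push Not at this
    rw [this.1.bar_snd, h2]
    exact ENNReal.ofReal_le_ofReal this.2
  · intro j hj
    have : ¬ (S'.IsFin j → 2 * δ < S'.finish j - S'.start j) := fun h => hj (hMj j h)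
    push Not at this
    rw [this.1.bar_snd, h2]
    exact ENNReal.ofReal_le_ofReal this.2

end Stability

end SingularValueDecomposition

/-! ### Floer-type complexes: stability of barcodes -/

namespace FloerComplex

open NovikovField

variable {K : Type u} [Field K] {Γ : AddSubgroup ℝ} (C D : FloerComplex.{v} K Γ)

/-- A shortcut instance: the general search tries the module structures of subfields first. -/
instance (priority := 10000) (k : ℤ) :
    @Module (NovikovField K Γ) (C.cycles k) _ (C.cycles k).addCommGroup.toAddCommMonoid :=
  (C.cycles k).module

theorem isFiltrationFunction (k : ℤ) :
    IsFiltrationFunction (K := K) (Γ := Γ) (C.ℓ k) := (C.orthogonalizable k).isFiltrationFunction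

theorem cycles_isOrthogonalizable (k : ℤ) :
    IsOrthogonalizable K Γ (C.cycles k) (C.cyclesLevel k) :=
  (C.orthogonalizable k).ker (C.orthogonalizable (k - 1)) _

theorem cycles_isFiltrationFunction (k : ℤ) :
    IsFiltrationFunction (K := K) (Γ := Γ) (C.cyclesLevel k) :=
  (C.cycles_isOrthogonalizable k).isFiltrationFunction

/-- A singular value decomposition of `∂_{k+1} : C_{k+1} → Z_k`. -/
abbrev SVD (k : ℤ) : Type _ :=
  SingularValueDecomposition (C.ℓ (k + 1)) (C.cyclesLevel k) (C.toCycles k)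

theorem nonempty_SVD (k : ℤ) : Nonempty (C.SVD k) :=
  nonempty_singularValueDecomposition (C.orthogonalizable _) (C.cycles_isOrthogonalizable k) _

theorem exists_isConciseBarcode (k : ℤ) : ∃ B, C.IsConciseBarcode k B := by
  obtain ⟨S⟩ := C.nonempty_SVD k
  exact ⟨_, _, ⟨S, rfl⟩, rfl⟩

variable {C D}

theorem ℓ_d_le' {k' k : ℤ} (h : k' + 1 = k) (c : C.X.X k) :
    C.ℓ k' ((C.X.d k k').hom c) ≤ C.ℓ k c := by
  obtain rfl : k' = k - 1 := by omega
  exact C.ℓ_d_le k c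

theorem mem_cycles_iff {k' k : ℤ} (h : k' + 1 = k) (c : C.X.X k) :
    c ∈ C.cycles k ↔ (C.X.d k k').hom c = 0 := by
  obtain rfl : k' = k - 1 := by omega
  exact LinearMap.mem_ker

theorem map_mem_cycles (f : C.X ⟶ D.X) (k : ℤ) {c : C.X.X k} (hc : c ∈ C.cycles k) :
    (f.f k).hom c ∈ D.cycles k := by
  have hc' : (C.X.d k (k - 1)).hom c = 0 := hc
  have h := congrArg (fun φ => φ.hom c) (f.comm k (k - 1))
  simp only [ModuleCat.hom_comp, LinearMap.comp_apply, hc', map_zero] at h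
  exact h

/-- The map on cycles induced by a chain map. -/
def mapCycles (f : C.X ⟶ D.X) (k : ℤ) : C.cycles k →ₗ[NovikovField K Γ] D.cycles k :=
  (f.f k).hom.restrict fun _ hc => map_mem_cycles f k hc

theorem toCycles_map (f : C.X ⟶ D.X) (k : ℤ) (c : C.X.X (k + 1)) :
    D.toCycles k ((f.f (k + 1)).hom c) = mapCycles f k (C.toCycles k c) := by
  apply Subtype.ext
  exact congrArg (fun φ => φ.hom c) (f.comm (k + 1) k)

/-- On a cycle the term `K ∂` of the homotopy formula vanishes. -/
theorem mapCycles_comp_of_homotopy {f : C.X ⟶ D.X} {g : D.X ⟶ C.X} (H : Homotopy (f ≫ g) (𝟙 C.X))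
    (k : ℤ) (z : C.cycles k) :
    mapCycles g k (mapCycles f k z) = C.toCycles k ((H.hom k (k + 1)).hom z) + z := by
  apply Subtype.ext
  have hz : (C.X.d k (k - 1)).hom z.1 = 0 := z.2
  have h := congrArg (fun φ => φ.hom z.1) (H.comm k)
  rw [dNext_eq H.hom (show (ComplexShape.down ℤ).Rel k (k - 1) by simp),
    prevD_eq H.hom (show (ComplexShape.down ℤ).Rel (k + 1) k by simp)] at h
  have h' : (g.f k).hom ((f.f k).hom z.1) =
      (C.X.d (k + 1) k).hom ((H.hom k (k + 1)).hom z.1) + z.1 := by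
    simpa [hz] using h
  exact h'

theorem Quasiequivalence.hasMatching {δ : ℝ≥0} (Q : Quasiequivalence C D δ) {k : ℤ}
    {B B' : Multiset ((ℝ ⧸ Γ) × ℝ≥0∞)} (hB : C.IsConciseBarcode k B)
    (hB' : D.IsConciseBarcode k B') : Barcode.HasMatching δ B B' := by
  obtain ⟨_, ⟨S, rfl⟩, rfl⟩ := hB
  obtain ⟨_, ⟨S', rfl⟩, rfl⟩ := hB'
  exact SingularValueDecomposition.hasMatching (TV := (Q.Φ.f (k + 1)).hom)
    (TW := mapCycles Q.Φ k) (UV := (Q.Ψ.f (k + 1)).hom) (UW := mapCycles Q.Ψ k)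
    (H := (Q.KC.hom k (k + 1)).hom ∘ₗ (C.cycles k).subtype)
    (H' := (Q.KD.hom k (k + 1)).hom ∘ₗ (D.cycles k).subtype)
    (C.isFiltrationFunction _) (D.isFiltrationFunction _) (C.cycles_isFiltrationFunction k)
    (D.cycles_isFiltrationFunction k) (fun v => ℓ_d_le' rfl v) (fun v => ℓ_d_le' rfl v)
    (toCycles_map Q.Φ k) (Q.Φ_le _) (fun w => Q.Φ_le _ w.1) (toCycles_map Q.Ψ k) (Q.Ψ_le _)
    (fun w => Q.Ψ_le _ w.1) (mapCycles_comp_of_homotopy Q.KC k) (fun w => Q.KC_le _ w.1)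
    (mapCycles_comp_of_homotopy Q.KD k) (fun w => Q.KD_le _ w.1)

theorem dB_le_dQ {k : ℤ} {B B' : Multiset ((ℝ ⧸ Γ) × ℝ≥0∞)} (hB : C.IsConciseBarcode k B)
    (hB' : D.IsConciseBarcode k B') : Barcode.dB B B' ≤ C.dQ D :=
  le_iInf₂ fun δ ⟨Q⟩ => iInf₂_le δ (Q.hasMatching hB hB')

end FloerComplex

/-! ### Quasiequivalences from matchings -/

namespace SingularValueDecomposition

variable {K : Type*} [Field K] {Γ : AddSubgroup ℝ}
variable {V : Type*} [AddCommGroup V] [Module (NovikovField K Γ) V] {ℓV : V → WithBot ℝ}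
variable {W : Type*} [AddCommGroup W] [Module (NovikovField K Γ) W] {ℓW : W → WithBot ℝ}
variable {A : V →ₗ[NovikovField K Γ] W}

/-- An orthogonal basis of the kernel extends by the vectors `yⱼ` with `j < r`. -/
theorem isOrthogonalBasis_lift (S : SingularValueDecomposition ℓV ℓW A)
    (hV : IsFiltrationFunction (K := K) (Γ := Γ) ℓV) {κ : Type*} [Fintype κ]
    [Fintype {j // S.IsFin j}] {z : κ → V} (hzA : ∀ k, A (z k) = 0) (hz0 : ∀ k, z k ≠ 0)
    (hz : ∀ (a : κ → NovikovField K Γ) (i : κ), ℓV (a i • z i) ≤ ℓV (∑ i, a i • z i))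
    (hspan : LinearMap.ker A ≤ Submodule.span (NovikovField K Γ) (Set.range z)) :
    IsOrthogonalBasis K Γ ℓV (Sum.elim (fun j : {j // S.IsFin j} => S.lift j.1) z) := by
  classical
  refine ⟨fun a => ?_, ?_, ?_⟩
  · rw [Fintype.sum_sum_type]
    simp only [Sum.elim_inl, Sum.elim_inr]
    set t := ∑ j : {j // S.IsFin j}, a (Sum.inl j) • S.lift j.1
      + ∑ k, a (Sum.inr k) • z k with ht
    -- Applying `A` kills the kernel part, so the coefficients of the lifts can be read off from `A
    -- t`.
    have hAt : ∀ j : {j // S.IsFin j}, S.x.repr (A t) j.1 = a (Sum.inl j) := by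
      intro j
      have : A t = ∑ j : {j // S.IsFin j}, a (Sum.inl j) • S.x j.1 := by
        rw [ht, map_add, map_sum, map_sum]
        simp only [map_smul, hzA, smul_zero, Finset.sum_const_zero, add_zero]
        exact Finset.sum_congr rfl fun j _ => by rw [j.2.map_lift]
      rw [this]
      simp only [map_sum, map_smul, Module.Basis.repr_self, Finsupp.finsetSum_apply,
        Finsupp.smul_apply]
      rw [Finset.sum_eq_single j]
      · simp
      · intro b _ hb
        rw [Finsupp.single_eq_of_ne (fun h => hb (Subtype.ext h.symm)), smul_zero]
      · simp
    have hl : ∀ j : {j // S.IsFin j}, ℓV (a (Sum.inl j) • S.lift j.1) ≤ ℓV t := by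
      intro j
      rw [← hAt j]
      exact repr_smul_lift_le hV t j.1
    rintro (j | k)
    · exact hl j
    · refine (hz (fun k => a (Sum.inr k)) k).trans ?_
      have : ∑ k, a (Sum.inr k) • z k
          = t - ∑ j : {j // S.IsFin j}, a (Sum.inl j) • S.lift j.1 := by rw [ht]; abel
      rw [this]
      exact (hV.sub_le _ _).trans (max_le le_rfl (hV.sum_le fun j _ => hl j))
  · rintro (j | k)
    · exact j.2.lift_ne_zero
    · exact hz0 k
  · rw [Set.Sum.elim_range, Submodule.span_union]
    rintro t -
    have h1 : ∑ j : {j // S.IsFin j}, S.x.repr (A t) j.1 • S.lift j.1 ∈ Submodule.span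
        (NovikovField K Γ) (Set.range fun j : {j // S.IsFin j} => S.lift j.1) :=
      Submodule.sum_mem _ fun j _ => Submodule.smul_mem _ _ (Submodule.subset_span ⟨j, rfl⟩)
    -- Subtracting the canonical preimage of `A t` leaves a kernel element.
    have h2 : t - ∑ j : {j // S.IsFin j}, S.x.repr (A t) j.1 • S.lift j.1 ∈ LinearMap.ker A := by
      rw [LinearMap.mem_ker, map_sub, map_sum, sub_eq_zero]
      conv_lhs => rw [← S.x.sum_repr (A t)]
      rw [← Finset.sum_subset (Finset.subset_univ
        (Finset.univ.map (Function.Embedding.subtype _)))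
        (fun k _ hk => by
          rw [repr_map_eq_zero (S := S) (fun h => hk (Finset.mem_map.mpr
            ⟨⟨k, h⟩, Finset.mem_univ _, rfl⟩)), zero_smul]), Finset.sum_map]
      exact Finset.sum_congr rfl fun j _ => by
        rw [map_smul, j.2.map_lift]
        rfl
    have := Submodule.add_mem_sup h1 (hspan h2)
    rwa [add_sub_cancel] at this

end SingularValueDecomposition

/-! ### Bases of bar endpoints and maps induced by matchings -/

namespace FloerComplex

open NovikovField SingularValueDecomposition

variable {K : Type u} [Field K] {Γ : AddSubgroup ℝ} {C D : FloerComplex.{v} K Γ}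

/-- The cycle at which the `j`-th bar starts. -/
def startVec (S : ∀ k, C.SVD k) (k : ℤ) (j : Fin (S k).m) : C.X.X k := ((S k).x j).1

/-- The chain at which the `j`-th bar ends, or `0` if the bar is infinite. -/
def finishVec (S : ∀ k, C.SVD k) {k' k : ℤ} (h : k' + 1 = k) (j : Fin (S k').m) : C.X.X k :=
  h ▸ (S k').lift j

variable (S : ∀ k, C.SVD k)

theorem startVec_ne_zero (k : ℤ) (j : Fin (S k).m) : startVec S k j ≠ 0 :=
  fun h => (S k).x.ne_zero j (Subtype.ext h)

theorem ℓ_startVec (k : ℤ) (j : Fin (S k).m) :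
    C.ℓ k (startVec S k j) = (((S k).start j : ℝ) : WithBot ℝ) :=
  ((C.cycles_isFiltrationFunction k).coe_realLevel ((S k).x.ne_zero j)).symm

theorem d_startVec {k' k : ℤ} (h : k' + 1 = k) (j : Fin (S k).m) :
    (C.X.d k k').hom (startVec S k j) = 0 :=
  (mem_cycles_iff h _).mp ((S k).x j).2

theorem finishVec_eq_zero {k' k : ℤ} (h : k' + 1 = k) {j : Fin (S k').m} (hj : ¬ (S k').IsFin j) :
    finishVec S h j = 0 := by
  subst h
  exact lift_eq_zero hj

theorem finishVec_ne_zero {k' k : ℤ} (h : k' + 1 = k) {j : Fin (S k').m} (hj : (S k').IsFin j) :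
    finishVec S h j ≠ 0 := by
  subst h
  exact hj.lift_ne_zero

theorem ℓ_finishVec {k' k : ℤ} (h : k' + 1 = k) {j : Fin (S k').m} (hj : (S k').IsFin j) :
    C.ℓ k (finishVec S h j) = (((S k').finish j : ℝ) : WithBot ℝ) := by
  subst h
  rw [hj.finish_eq]
  exact ((C.isFiltrationFunction _).coe_realLevel hj.lift_ne_zero).symm

theorem d_finishVec {k' k : ℤ} (h : k' + 1 = k) {j : Fin (S k').m} (hj : (S k').IsFin j) :
    (C.X.d k k').hom (finishVec S h j) = startVec S k' j := by
  subst h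
  exact congrArg Subtype.val hj.map_lift

theorem realLevel_finishVec {k' k : ℤ} (h : k' + 1 = k) {j : Fin (S k').m} (hj : (S k').IsFin j) :
    realLevel (C.ℓ k) (finishVec S h j) = (S k').finish j := by
  rw [realLevel, ℓ_finishVec S h hj, WithBot.unbotD_coe]

/-- The index type of the basis of `C_k` formed by the endpoints of bars. -/
abbrev EndIndex (k : ℤ) : Type := {j : Fin (S (k - 1)).m // (S (k - 1)).IsFin j} ⊕ Fin (S k).m

instance (k : ℤ) : Fintype (EndIndex S k) := by
  classical
  infer_instance

/-- The basis of `C_k` formed by the endpoints of bars. -/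
def endVec (k : ℤ) : EndIndex S k → C.X.X k :=
  Sum.elim (fun j => finishVec S (sub_add_cancel k 1) j.1) (startVec S k)

theorem endVec_isOrthogonalBasis (k : ℤ) : IsOrthogonalBasis K Γ (C.ℓ k) (endVec S k) := by
  classical
  -- With `k'` and `k` independent, the cast along `k' + 1 = k` disappears by substitution, which is
  -- not possible directly for `k - 1 + 1 = k`.
  have key : ∀ {k' k : ℤ} (h : k' + 1 = k), IsOrthogonalBasis K Γ (C.ℓ k)
      (Sum.elim (fun j : {j : Fin (S k').m // (S k').IsFin j} => finishVec S h j.1)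
        (startVec S k)) := by
    intro k' k h
    subst h
    refine (S k').isOrthogonalBasis_lift (C.isFiltrationFunction _) (fun j => ?_)
      (startVec_ne_zero S _) ?_ ?_
    · exact Subtype.ext (d_startVec S rfl j)
    · intro a i
      have := (C.cycles_isFiltrationFunction (k' + 1)).isOrthogonalFamily_iff.mp
        (S (k' + 1)).x_orthogonal a i
      refine this.trans_eq (congrArg (C.ℓ (k' + 1)) ?_)
      simp [startVec]
    · intro z hz
      have hz' : z ∈ C.cycles (k' + 1) := (mem_cycles_iff rfl z).mpr (congrArg Subtype.val hz)
      have := congrArg Subtype.val ((S (k' + 1)).x.sum_repr ⟨z, hz'⟩)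
      simp only [Submodule.coe_sum, Submodule.coe_smul] at this
      rw [← this]
      exact Submodule.sum_mem _ fun j _ => Submodule.smul_mem _ _ (Submodule.subset_span ⟨j, rfl⟩)
  convert key (sub_add_cancel k 1) using 1
  rfl

attribute [irreducible] finishVec

/-- The basis `endVec`, bundled. -/
def endBasis (k : ℤ) : Module.Basis (EndIndex S k) (NovikovField K Γ) (C.X.X k) :=
  (endVec_isOrthogonalBasis S k).basis (C.isFiltrationFunction k)

theorem endBasis_inr (k : ℤ) (j : Fin (S k).m) : endBasis S k (Sum.inr j) = startVec S k j :=
  (endVec_isOrthogonalBasis S k).basis_apply _ _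

theorem endBasis_inl (k : ℤ) (j : {j : Fin (S (k - 1)).m // (S (k - 1)).IsFin j}) :
    endBasis S k (Sum.inl j) = finishVec S (sub_add_cancel k 1) j.1 :=
  (endVec_isOrthogonalBasis S k).basis_apply _ _

theorem end_ext {U : Type*} [AddCommGroup U] [Module (NovikovField K Γ) U] {k' k : ℤ}
    (h : k' + 1 = k) {f g : C.X.X k →ₗ[NovikovField K Γ] U}
    (hstart : ∀ j, f (startVec S k j) = g (startVec S k j))
    (hfinish : ∀ j, (S k').IsFin j → f (finishVec S h j) = g (finishVec S h j)) : f = g := by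
  obtain rfl : k' = k - 1 := by omega
  refine (endBasis S k).ext ?_
  rintro (j | j)
  · rw [endBasis_inl]
    exact hfinish j.1 j.2
  · rw [endBasis_inr]
    exact hstart j

/-- The linear map with prescribed values `q` at the starts and `p` at the finishs of bars. -/
def endMap {U : Type*} [AddCommGroup U] [Module (NovikovField K Γ) U] (k : ℤ)
    (p : Fin (S (k - 1)).m → U) (q : Fin (S k).m → U) : C.X.X k →ₗ[NovikovField K Γ] U :=
  (endBasis S k).constr (NovikovField K Γ) (Sum.elim (fun j => p j.1) q)

theorem endMap_startVec {U : Type*} [AddCommGroup U] [Module (NovikovField K Γ) U] (k : ℤ)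
    (p : Fin (S (k - 1)).m → U) (q : Fin (S k).m → U) (j : Fin (S k).m) :
    endMap S k p q (startVec S k j) = q j := by
  rw [endMap, ← endBasis_inr, Module.Basis.constr_basis, Sum.elim_inr]

/-- The finish of an infinite bar is the default value `0` and not a basis vector, whence the
condition on `p`. -/
theorem endMap_finishVec {U : Type*} [AddCommGroup U] [Module (NovikovField K Γ) U] (k : ℤ)
    (p : Fin (S (k - 1)).m → U) (q : Fin (S k).m → U) (j : Fin (S (k - 1)).m)
    (hp : ¬ (S (k - 1)).IsFin j → p j = 0) :
    endMap S k p q (finishVec S (sub_add_cancel k 1) j) = p j := by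
  by_cases hj : (S (k - 1)).IsFin j
  · rw [endMap, ← endBasis_inl S k ⟨j, hj⟩, Module.Basis.constr_basis, Sum.elim_inl]
  · rw [finishVec_eq_zero S _ hj, map_zero, hp hj]

theorem map_le_of_end {U : Type*} [AddCommGroup U] [Module (NovikovField K Γ) U]
    {ℓU : U → WithBot ℝ} (hU : IsFiltrationFunction (K := K) (Γ := Γ) ℓU) {k' k : ℤ}
    (h : k' + 1 = k) {f : C.X.X k →ₗ[NovikovField K Γ] U} {c : ℝ}
    (hstart : ∀ j, ℓU (f (startVec S k j)) ≤ (((S k).start j + c : ℝ) : WithBot ℝ))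
    (hfinish : ∀ j, (S k').IsFin j →
      ℓU (f (finishVec S h j)) ≤ (((S k').finish j + c : ℝ) : WithBot ℝ)) (x : C.X.X k) :
    ℓU (f x) ≤ C.ℓ k x + (c : WithBot ℝ) := by
  obtain rfl : k' = k - 1 := by omega
  refine (endVec_isOrthogonalBasis S k).map_le (C.isFiltrationFunction k) hU f ?_ x
  rintro (j | j)
  · change ℓU (f (finishVec S h j.1)) ≤ C.ℓ k (finishVec S h j.1) + _
    rw [ℓ_finishVec S h j.2]
    exact_mod_cast hfinish j.1 j.2
  · change ℓU (f (startVec S k j)) ≤ C.ℓ k (startVec S k j) + _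
    rw [ℓ_startVec]
    exact_mod_cast hstart j

section Transport

variable {I J U : Type*} [AddCommGroup U] [Module (NovikovField K Γ) U]

open Classical in
/-- The family indexed by `I` whose `i`-th member is `T^{g i j} u_j` if `i` is matched with `j`,
and `0` if `i` is unmatched. -/
def transport (M : I → J → Prop) (g : I → J → Γ) (u : J → U) (i : I) : U :=
  if h : ∃ j, M i j then monomial K (g i h.choose) • u h.choose else 0

theorem transport_of {M : I → J → Prop} (hM : Relator.RightUnique M) (g : I → J → Γ) (u : J → U)
    {i : I} {j : J} (h : M i j) :
    transport (K := K) M g u i = monomial K (g i j) • u j := by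
  have h' : ∃ j, M i j := ⟨j, h⟩
  rw [transport, dif_pos h', hM h'.choose_spec h]

theorem transport_of_not {M : I → J → Prop} (g : I → J → Γ) (u : J → U) {i : I}
    (h : ¬ ∃ j, M i j) : transport (K := K) M g u i = 0 := dif_neg h

end Transport

variable (S' : ∀ k, D.SVD k)

section MatchingMap

variable (M : ∀ k, Fin (S k).m → Fin (S' k).m → Prop) (g : ∀ k, Fin (S k).m → Fin (S' k).m → Γ)

/-- The linear map induced by a matching of bars. -/
def matchingMap (k : ℤ) : C.X.X k →ₗ[NovikovField K Γ] D.X.X k :=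
  endMap S k (transport (K := K) (M (k - 1)) (g (k - 1)) (finishVec S' (sub_add_cancel k 1)))
    (transport (K := K) (M k) (g k) (startVec S' k))

variable {S S' M g}

theorem matchingMap_startVec (k : ℤ) (i : Fin (S k).m) :
    matchingMap S S' M g k (startVec S k i) =
      transport (K := K) (M k) (g k) (startVec S' k) i :=
  endMap_startVec _ _ _ _ _

theorem matchingMap_finishVec (hM : ∀ k, Relator.RightUnique (M k))
    (hfin : ∀ k i j, M k i j → ((S k).IsFin i ↔ (S' k).IsFin j))
    {k' k : ℤ} (h : k' + 1 = k) (i : Fin (S k').m) :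
    matchingMap S S' M g k (finishVec S h i) =
      transport (K := K) (M k') (g k') (finishVec S' h) i := by
  obtain rfl : k' = k - 1 := by omega
  refine endMap_finishVec _ _ _ _ _ fun hi => ?_
  by_cases hex : ∃ j, M (k - 1) i j
  · obtain ⟨j, hj⟩ := hex
    rw [transport_of (hM (k - 1)) _ _ hj,
      finishVec_eq_zero S' h (fun hf => hi ((hfin _ i j hj).mpr hf)), smul_zero]
  · exact transport_of_not _ _ hex

theorem d_matchingMap (hM : ∀ k, Relator.RightUnique (M k))
    (hfin : ∀ k i j, M k i j → ((S k).IsFin i ↔ (S' k).IsFin j)) {k' k : ℤ} (h : k' + 1 = k) :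
    (D.X.d k k').hom ∘ₗ matchingMap S S' M g k = matchingMap S S' M g k' ∘ₗ (C.X.d k k').hom := by
  refine end_ext S h (fun i => ?_) (fun i hi => ?_)
  · rw [LinearMap.comp_apply, LinearMap.comp_apply, d_startVec S h, map_zero,
      matchingMap_startVec]
    by_cases hex : ∃ j, M k i j
    · obtain ⟨j, hj⟩ := hex
      rw [transport_of (hM k) _ _ hj, map_smul, d_startVec S' h, smul_zero]
    · rw [transport_of_not _ _ hex, map_zero]
  · rw [LinearMap.comp_apply, LinearMap.comp_apply, d_finishVec S h hi, matchingMap_startVec,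
      matchingMap_finishVec hM hfin]
    by_cases hex : ∃ j, M k' i j
    · obtain ⟨j, hj⟩ := hex
      rw [transport_of (hM k') _ _ hj, transport_of (hM k') _ _ hj, map_smul,
        d_finishVec S' h ((hfin k' i j hj).mp hi)]
    · rw [transport_of_not _ _ hex, transport_of_not _ _ hex, map_zero]

theorem matchingMap_le {c : ℝ} (hM : ∀ k, Relator.RightUnique (M k))
    (hfin : ∀ k i j, M k i j → ((S k).IsFin i ↔ (S' k).IsFin j))
    (hstart : ∀ k i j, M k i j → (S' k).start j - g k i j ≤ (S k).start i + c)
    (hfinish : ∀ k i j, M k i j → (S' k).finish j - g k i j ≤ (S k).finish i + c) (k : ℤ) (x : C.X.X k) :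
    D.ℓ k (matchingMap S S' M g k x) ≤ C.ℓ k x + (c : WithBot ℝ) := by
  have hD := D.isFiltrationFunction k
  refine map_le_of_end S hD (sub_add_cancel k 1) (fun i => ?_) (fun i hi => ?_) x
  · rw [matchingMap_startVec]
    by_cases hex : ∃ j, M k i j
    · obtain ⟨j, hj⟩ := hex
      rw [transport_of (hM k) _ _ hj, hD.smul_le_coe_iff (startVec_ne_zero S' k j),
        val_monomial]
      intro _
      exact hstart k i j hj
    · rw [transport_of_not _ _ hex, hD.map_zero]
      exact bot_le
  · rw [matchingMap_finishVec hM hfin]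
    by_cases hex : ∃ j, M (k - 1) i j
    · obtain ⟨j, hj⟩ := hex
      have hf := (hfin (k - 1) i j hj).mp hi
      rw [transport_of (hM (k - 1)) _ _ hj,
        hD.smul_le_coe_iff (finishVec_ne_zero S' (sub_add_cancel k 1) hf), val_monomial,
        realLevel_finishVec S' (sub_add_cancel k 1) hf]
      intro _
      exact hfinish (k - 1) i j hj
    · rw [transport_of_not _ _ hex, hD.map_zero]
      exact bot_le

/-- The chain map induced by a matching of bars. -/
def matchingChainMap (hM : ∀ k, Relator.RightUnique (M k))
    (hfin : ∀ k i j, M k i j → ((S k).IsFin i ↔ (S' k).IsFin j)) : C.X ⟶ D.X where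
  f k := ModuleCat.ofHom (matchingMap S S' M g k)
  comm' _ _ h := ModuleCat.hom_ext (d_matchingMap hM hfin h)

end MatchingMap

open Classical in
/-- A chain map that projects onto the span of some of the bars is homotopic to the identity if all
other bars are short. -/
theorem exists_homotopy {f : C.X ⟶ C.X} {P : ∀ k, Fin (S k).m → Prop} {c : ℝ}
    (hstart : ∀ k i, (f.f k).hom (startVec S k i) = if P k i then startVec S k i else 0)
    (hfinish : ∀ k' k (h : k' + 1 = k) i,
      (f.f k).hom (finishVec S h i) = if P k' i then finishVec S h i else 0)
    (hP : ∀ k i, ¬ P k i → (S k).IsFin i ∧ (S k).finish i ≤ (S k).start i + c) :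
    ∃ H : Homotopy f (𝟙 C.X),
      ∀ k x, C.ℓ (k + 1) ((H.hom k (k + 1)).hom x) ≤ C.ℓ k x + (c : WithBot ℝ) := by
  -- On an unmatched bar `f - 1 = -1`. With `x ↦ -y` and `y ↦ 0`, the operator `∂η + η∂` equals `-1`
  -- on both endpoints, and `η` raises the level by exactly the length of the bar.
  let η : ∀ k' k : ℤ, k' + 1 = k → (C.X.X k' →ₗ[NovikovField K Γ] C.X.X k) := fun k' k h =>
    endMap S k' (fun _ => 0) (fun i => if P k' i then 0 else -finishVec S h i)
  have hη1 : ∀ (k' k : ℤ) (h : k' + 1 = k) i, η k' k h (startVec S k' i) =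
      if P k' i then 0 else -finishVec S h i := fun k' k h i => endMap_startVec _ _ _ _ _
  have hη2 : ∀ (k' k : ℤ) (h : k' + 1 = k) i,
      η k' k h (finishVec S (sub_add_cancel k' 1) i) = 0 :=
    fun k' k h i => endMap_finishVec _ _ _ _ _ fun _ => rfl
  let hom : ∀ i j, C.X.X i ⟶ C.X.X j := fun i j =>
    if h : i + 1 = j then ModuleCat.ofHom (η i j h) else 0
  have hom_eq : ∀ {i j : ℤ} (h : i + 1 = j), hom i j = ModuleCat.ofHom (η i j h) :=
    fun h => dif_pos h
  refine ⟨⟨hom, fun i j hij => dif_neg hij, fun k => ?_⟩, fun k => ?_⟩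
  · have h1 : k - 1 + 1 = k := sub_add_cancel k 1
    rw [dNext_eq hom (show (ComplexShape.down ℤ).Rel k (k - 1) from h1),
      prevD_eq hom (show (ComplexShape.down ℤ).Rel (k + 1) k from rfl), hom_eq h1, hom_eq rfl]
    apply ModuleCat.hom_ext
    refine end_ext S h1 (fun i => ?_) (fun i hi => ?_)
    · simp only [ModuleCat.hom_comp, ModuleCat.hom_add, ModuleCat.hom_ofHom, LinearMap.add_apply,
        LinearMap.comp_apply, HomologicalComplex.id_f, ModuleCat.hom_id, LinearMap.id_apply,
        d_startVec S h1, map_zero, hη1, hstart]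
      split_ifs with h
      · simp
      · rw [map_neg, d_finishVec S rfl (hP k i h).1]
        simp
    · simp only [ModuleCat.hom_comp, ModuleCat.hom_add, ModuleCat.hom_ofHom, LinearMap.add_apply,
        LinearMap.comp_apply, HomologicalComplex.id_f, ModuleCat.hom_id, LinearMap.id_apply,
        d_finishVec S h1 hi, map_zero, hη1, hη2, hfinish]
      split_ifs with h
      · simp
      · simp
  · have hC := C.isFiltrationFunction (k + 1)
    change ∀ x, C.ℓ (k + 1) ((hom k (k + 1)).hom x) ≤ _
    rw [hom_eq rfl]
    refine map_le_of_end S hC (sub_add_cancel k 1) (fun i => ?_) (fun i hi => ?_)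
    · rw [ModuleCat.hom_ofHom, hη1]
      split_ifs with h
      · rw [hC.map_zero]
        exact bot_le
      · rw [hC.map_neg, ℓ_finishVec S rfl (hP k i h).1, WithBot.coe_le_coe]
        exact (hP k i h).2
    · rw [ModuleCat.hom_ofHom, hη2, hC.map_zero]
      exact bot_le

open Classical in
/-- Transporting along a matching and back. -/
theorem transport_transport {I J U U' : Type*} [AddCommGroup U] [Module (NovikovField K Γ) U]
    [AddCommGroup U'] [Module (NovikovField K Γ) U'] {M : I → J → Prop} (hM : Relator.BiUnique M)
    {g : I → J → Γ} {u : I → U} {u' : J → U'} {f : U' →ₗ[NovikovField K Γ] U}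
    (hf : ∀ j, f (u' j) =
      transport (K := K) (fun j i => M i j) (fun j i => -g i j) u j) (i : I) :
    f (transport (K := K) M g u' i) = if ∃ j, M i j then u i else 0 := by
  by_cases h : ∃ j, M i j
  · obtain ⟨j, hj⟩ := id h
    rw [if_pos h, transport_of hM.2 _ _ hj, map_smul, hf,
      transport_of (M := fun j i => M i j) (fun _ _ _ h h' => hM.1 h h') _ _ hj, smul_smul,
      monomial_mul, add_neg_cancel, monomial_zero, one_smul]
  · rw [if_neg h, transport_of_not _ _ h, map_zero]

/-- Using `T^g` in one direction and `T^{-g}` in the other makes the two maps mutually inverse on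
matched bars; unmatched bars are finite and short, hence contractible within `2c`. -/
theorem nonempty_quasiequivalence {M : ∀ k, Fin (S k).m → Fin (S' k).m → Prop} {c : ℝ≥0}
    (hM : ∀ k, Relator.BiUnique (M k)) (hR : ∀ k i j, M k i j → Related (S k) (S' k) c i j)
    (hI : ∀ k i, (¬ ∃ j, M k i j) → (S k).IsFin i ∧ (S k).finish i ≤ (S k).start i + 2 * c)
    (hJ : ∀ k j, (¬ ∃ i, M k i j) → (S' k).IsFin j ∧ (S' k).finish j ≤ (S' k).start j + 2 * c) :
    Nonempty (Quasiequivalence C D c) := by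
  have hg : ∀ k i j, ∃ g : Γ, M k i j → |(S' k).start j - g - (S k).start i| ≤ c ∧
      |(S' k).finish j - g - (S k).finish i| ≤ c := by
    intro k i j
    by_cases h : M k i j
    · obtain ⟨-, g, hg, h'⟩ := hR k i j h
      exact ⟨⟨g, hg⟩, fun _ => h'⟩
    · exact ⟨0, fun h' => absurd h' h⟩
  choose g hg using hg
  have hfin := fun k i j (h : M k i j) => (hR k i j h).1
  have hfin' := fun k j i (h : M k i j) => (hR k i j h).1.symm
  have hM' : ∀ k, Relator.BiUnique fun j i => M k i j := fun k =>
    ⟨fun _ _ _ h h' => (hM k).2 h h', fun _ _ _ h h' => (hM k).1 h h'⟩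
  let Φ : C.X ⟶ D.X := matchingChainMap (g := g) (fun k => (hM k).2) hfin
  let Ψ : D.X ⟶ C.X := matchingChainMap (M := fun k j i => M k i j) (g := fun k j i => -g k i j)
    (fun k => (hM' k).2) hfin'
  obtain ⟨HC, hHC⟩ := exists_homotopy S (f := Φ ≫ Ψ) (P := fun k i => ∃ j, M k i j) (c := 2 * c)
    (fun k i => by
      change matchingMap S' S (fun k j i => M k i j) (fun k j i => -g k i j) k
        (matchingMap S S' M g k _) = _
      rw [matchingMap_startVec, transport_transport (hM k) (matchingMap_startVec k)])
    (fun k' k h i => by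
      change matchingMap S' S (fun k j i => M k i j) (fun k j i => -g k i j) k
        (matchingMap S S' M g k _) = _
      rw [matchingMap_finishVec (fun k => (hM k).2) hfin, transport_transport (hM k')
        (matchingMap_finishVec (fun k => (hM' k).2) hfin' h)]) hI
  obtain ⟨HD, hHD⟩ := exists_homotopy S' (f := Ψ ≫ Φ) (P := fun k j => ∃ i, M k i j) (c := 2 * c)
    (fun k i => by
      change matchingMap S S' M g k
        (matchingMap S' S (fun k j i => M k i j) (fun k j i => -g k i j) k _) = _
      rw [matchingMap_startVec, transport_transport (hM' k)
        (by simpa using matchingMap_startVec (g := g) k)])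
    (fun k' k h i => by
      change matchingMap S S' M g k
        (matchingMap S' S (fun k j i => M k i j) (fun k j i => -g k i j) k _) = _
      rw [matchingMap_finishVec (fun k => (hM' k).2) hfin', transport_transport (hM' k')
        (by simpa using matchingMap_finishVec (g := g) (fun k => (hM k).2) hfin h)]) hJ
  refine ⟨⟨Φ, Ψ, HC, HD, ?_, ?_, hHC, hHD⟩⟩
  · refine matchingMap_le (M := M) (g := g) (fun k => (hM k).2) hfin (fun k i j h => ?_) (fun k i j h => ?_)
    · linarith [(abs_le.mp (hg k i j h).1).2]
    · linarith [(abs_le.mp (hg k i j h).2).2]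
  · refine matchingMap_le (M := fun k j i => M k i j) (g := fun k j i => -g k i j)
      (fun k => (hM' k).2) hfin' (fun k j i h => ?_) (fun k j i h => ?_)
    · push_cast
      linarith [(abs_le.mp (hg k i j h).1).1]
    · push_cast
      linarith [(abs_le.mp (hg k i j h).2).1]

theorem isFin_and_finish_le_of_bar_le {k : ℤ} {δ c : ℝ≥0} (hδ : δ ≤ c) {i : Fin (S k).m}
    (h : ((S k).bar i).2 ≤ 2 * (δ : ℝ≥0∞)) :
    (S k).IsFin i ∧ (S k).finish i ≤ (S k).start i + 2 * c := by
  have h2 : (2 * (δ : ℝ≥0∞)) = ENNReal.ofReal (2 * δ) := by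
    rw [ENNReal.ofReal_mul (by norm_num)]
    simp
  rw [h2] at h
  have hi : (S k).IsFin i := by
    by_contra hi
    rw [bar_snd_eq_top hi] at h
    exact ENNReal.ofReal_ne_top (top_le_iff.mp h)
  rw [hi.bar_snd, ENNReal.ofReal_le_ofReal_iff (by positivity)] at h
  have : (δ : ℝ) ≤ c := hδ
  exact ⟨hi, by linarith⟩

theorem dQ_le_dBFamily {B B' : ℤ → Multiset ((ℝ ⧸ Γ) × ℝ≥0∞)}
    (hB : ∀ k, C.IsConciseBarcode k (B k)) (hB' : ∀ k, D.IsConciseBarcode k (B' k)) :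
    C.dQ D ≤ Barcode.dBFamily B B' := by
  by_contra! hlt
  -- The matching parameters `δ k` vary with the degree, while a quasiequivalence needs a single
  -- one. A number `c` strictly above the supremum serves for all degrees and also absorbs the `ε`
  -- of each matching.
  obtain ⟨c, hc1, hc2⟩ := ENNReal.lt_iff_exists_nnreal_btwn.mp hlt
  refine absurd ?_ (not_le.mpr hc2)
  have hmatch : ∀ k, ∃ δ : ℝ≥0, δ < c ∧ Barcode.HasMatching δ (B k) (B' k) := by
    intro k
    have h : Barcode.dB (B k) (B' k) < c :=
      (le_iSup (fun k => Barcode.dB (B k) (B' k)) k).trans_lt hc1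
    simp only [Barcode.dB, iInf_lt_iff] at h
    obtain ⟨δ, hδ, hlt⟩ := h
    exact ⟨δ, by exact_mod_cast hlt, hδ⟩
  choose δ hδ hmatch using hmatch
  choose B₀ hB₀ hB using hB
  choose B₀' hB₀' hB' using hB'
  choose S hS using hB₀
  choose S' hS' using hB₀'
  have hst : ∀ k i, (S k).start i ≤ (S k).finish i := fun k => start_le_finish
    (C.isFiltrationFunction _) (C.cycles_isFiltrationFunction k) fun v => ℓ_d_le' rfl v
  have hst' : ∀ k i, (S' k).start i ≤ (S' k).finish i := fun k => start_le_finish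
    (D.isFiltrationFunction _) (D.cycles_isFiltrationFunction k) fun v => ℓ_d_le' rfl v
  have hex := fun k => Barcode.HasMatching.exists_biUnique (δ := δ k) (p := (S k).bar)
    (q := (S' k).bar) (by
      rw [← verboseBarcode_eq, ← verboseBarcode_eq, ← hS, ← hS', ← hB, ← hB']
      exact hmatch k)
  choose M hM hMm hI hJ using hex
  have hQ := nonempty_quasiequivalence S S' (c := c) hM
    (fun k i j h => related_of_matched (hδ k) (hMm k i j h) (hst k i) (hst' k j))
    (fun k i h => isFin_and_finish_le_of_bar_le S (hδ k).le (hI k i h))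
    (fun k j h => isFin_and_finish_le_of_bar_le S' (hδ k).le (hJ k j h))
  exact iInf₂_le c hQ

end FloerComplex

end

theorem theorem1p4 {K : Type u} [Field K] {Γ : AddSubgroup ℝ}
    (C D : FloerComplex.{v, u} K Γ) :
    -- concise barcodes exist in every degree
    (∀ k : ℤ, ∃ B, C.IsConciseBarcode k B) ∧ (∀ k : ℤ, ∃ B, D.IsConciseBarcode k B) ∧
    -- and, whichever singular value decompositions they are computed from, they satisfy
    ∀ BC BD : ℤ → Multiset ((ℝ ⧸ Γ) × ℝ≥0∞),
      (∀ k, C.IsConciseBarcode k (BC k)) → (∀ k, D.IsConciseBarcode k (BD k)) →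
      (C.dQ D ≤ Barcode.dBFamily BC BD ∧ Barcode.dBFamily BC BD ≤ 2 * C.dQ D) ∧
      ∀ k : ℤ, C.dQ D < Barcode.minLength (BD k) / 4 →
        Barcode.dB (BC k) (BD k) ≤ C.dQ D := by
  refine ⟨C.exists_isConciseBarcode, D.exists_isConciseBarcode, fun BC BD hBC hBD =>
    ⟨⟨FloerComplex.dQ_le_dBFamily hBC hBD, ?_⟩, fun k _ => FloerComplex.dB_le_dQ (hBC k) (hBD k)⟩⟩
  refine (iSup_le fun k => FloerComplex.dB_le_dQ (hBC k) (hBD k)).trans ?_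
  -- The degreewise bound `d_B ≤ d_Q` is weakened by the factor 2.
  exact le_mul_of_one_le_left' one_le_two
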